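/- Let $\rho>0$ and $\sigma>0$. (Here $\rho=L/R$ is the dimensionless length of a circular tube of length $L$ and inner radius $R$, rescaled to radius $1$, and $\sigma$ is the dimensionless surface tension.) Let $$\mathcal C=\{x^2+y^2=1,\ 0\le z\le\rho\},\qquad \mathcal W=\{(0,s,0):|s|\le 1\}\cup\{(0,s,\rho):|s|\le 1\}$$ be the inner wall of the tube and the union of two parallel wires at its ends, let $Q=[-1,1]\times[0,\rho]$, with coordinates $(y,z)$, and let $$\mathcal S_0=\{(0,y,z):(y,z)\in Q\}$$ be the flat rectangular film. Call $g\in C^2(Q,\mathbb R^3)$ admissible if it is an injective immersion that maps the union of the edges $z=0$ and $z=\rho$ of $Q$ onto $\mathcal W$ and maps the open edges $\{\pm1\}\times(0,\rho)$ into $\mathcal C$; let $E(g)=\sigma\int_Q|g_y\times g_z|\,dy\,dz$ be the free energy of the surface $g(Q)$. The surface $\mathcal S_0$ is said to satisfy the second-variation stability condition if $$\frac{d^2}{dt^2}E(f(t))\Big|_{t=0}\ge 0$$ for every open interval $I\ni 0$ and every $f\in C^2(I,C^2(Q,\mathbb R^3))$ such that $f(t)$ is admissible for all $t\in I$ and $f(0)(Q)=\mathcal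 S_0$. Then $\mathcal S_0$ satisfies the second-variation stability condition if and only if $$1\le\frac{\pi}{\rho}\tanh\Big(\frac{\pi}{\rho}\Big).$$ Moreover, there is a number $\rho_c$ with $|\rho_c-2.62|<0.005$, independent of $\rho$ and $\sigma$, such that for every $\rho>0$ this inequality holds if and only if $\rho\le\rho_c$. -/

import Mathlib

open Set MeasureTheory

noncomputable section

namespace SoapFilm

/-- Three-dimensional Euclidean space; the coordinates `x, y, z` are those of index `0, 1, 2`. -/
abbrev R3 : Type := EuclideanSpace ℝ (Fin 3)

/-- The flat film `{x = 0, -1 ≤ y ≤ 1, 0 ≤ z ≤ ρ}`. -/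
def flatFilm (ρ : ℝ) : Set R3 :=
  {p | p 0 = 0 ∧ (-1 ≤ p 1 ∧ p 1 ≤ 1) ∧ (0 ≤ p 2 ∧ p 2 ≤ ρ)}

/-- The wire in the plane `z = 0`: the diameter along the `y`-axis. -/
def wireBottom : Set R3 :=
  {p | ∃ s : ℝ, -1 ≤ s ∧ s ≤ 1 ∧ p = !₂[0, s, 0]}

/-- The wire in the plane `z = ρ`: the diameter rotated by the angle `θ₀` from the `y`-axis. -/
def wireTop (θ₀ ρ : ℝ) : Set R3 :=
  {p | ∃ s : ℝ, -1 ≤ s ∧ s ≤ 1 ∧ p = !₂[-(s * Real.sin θ₀), s * Real.cos θ₀, ρ]}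

/-- The union of the two wires. -/
def wires (θ₀ ρ : ℝ) : Set R3 := wireBottom ∪ wireTop θ₀ ρ

/-- The inner wall of the tube: the circular cylinder of radius `1` and length `ρ`. -/
def cylinder (ρ : ℝ) : Set R3 :=
  {p | p 0 ^ 2 + p 1 ^ 2 = 1 ∧ 0 ≤ p 2 ∧ p 2 ≤ ρ}

/-- The closed rectangle `[-1, 1] × [0, ρ]` of the coordinates `(y, z)`, with which the flat film
is identified through `(y, z) ↦ (0, y, z)`; it is the domain of all parametrizations. -/
def rect (ρ : ℝ) : Set (ℝ × ℝ) := Icc (-1) 1 ×ˢ Icc 0 ρ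

instance instCompactSpaceRect (ρ : ℝ) : CompactSpace (rect ρ) :=
  isCompact_iff_compactSpace.mp (isCompact_Icc.prod isCompact_Icc)

/-- The two edges `z = 0` and `z = ρ` of the rectangle. -/
def wireEdges (ρ : ℝ) : Set (rect ρ) := {x | x.1.2 = 0 ∨ x.1.2 = ρ}

/-- The rest of the boundary of the rectangle: the edges `y = ±1` without their end points. -/
def lateralEdges (ρ : ℝ) : Set (rect ρ) :=
  {x | (x.1.1 = -1 ∨ x.1.1 = 1) ∧ 0 < x.1.2 ∧ x.1.2 < ρ}

/-- The linear map from `ℝ²` to `ℝ³` with the partial derivatives `a` and `b`. -/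
def linMap (a b : R3) : (ℝ × ℝ) →L[ℝ] R3 :=
  (ContinuousLinearMap.fst ℝ ℝ ℝ).smulRight a + (ContinuousLinearMap.snd ℝ ℝ ℝ).smulRight b

/-- The Banach space `C²([-1, 1] × [0, ρ], ℝ³)`. A map `g` which is of class `C²` up to the boundary
is represented by the continuous functions `(g, g_y, g_z, g_yy, g_yz, g_zz)` on the closed
rectangle, and its norm is the maximum of their supremum norms. -/
def C2Space (ρ : ℝ) : Submodule ℝ (Fin 6 → C(rect ρ, R3)) where
  carrier := {j | ∃ G : Fin 6 → ℝ × ℝ → R3, (∀ i, ∀ x : rect ρ, G i x = j i x) ∧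
    ∀ x : rect ρ, HasFDerivWithinAt (G 0) (linMap (j 1 x) (j 2 x)) (rect ρ) x ∧
      HasFDerivWithinAt (G 1) (linMap (j 3 x) (j 4 x)) (rect ρ) x ∧
      HasFDerivWithinAt (G 2) (linMap (j 4 x) (j 5 x)) (rect ρ) x}
  add_mem' := by
    rintro j k ⟨G, hG, h⟩ ⟨G', hG', h'⟩
    have hl : ∀ a b c d : R3, linMap (a + c) (b + d) = linMap a b + linMap c d := by
      intro a b c d
      refine ContinuousLinearMap.ext fun p => ?_
      simp [linMap]
      module
    refine ⟨fun i => G i + G' i, fun i x => by simp [hG, hG'], fun x => ?_⟩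
    simp only [Pi.add_apply, ContinuousMap.add_apply, hl]
    exact ⟨(h x).1.add (h' x).1, (h x).2.1.add (h' x).2.1, (h x).2.2.add (h' x).2.2⟩
  zero_mem' := by
    have hl : linMap 0 0 = 0 := by ext1 <;> simp [linMap]
    refine ⟨fun _ _ => 0, fun _ _ => rfl, fun x => ?_⟩
    simp only [Pi.zero_apply, ContinuousMap.zero_apply, hl]
    exact ⟨hasFDerivWithinAt_const _ _ _, hasFDerivWithinAt_const _ _ _,
      hasFDerivWithinAt_const _ _ _⟩
  smul_mem' := by
    rintro c j ⟨G, hG, h⟩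
    have hl : ∀ a b : R3, linMap (c • a) (c • b) = c • linMap a b := by
      intro a b
      refine ContinuousLinearMap.ext fun p => ?_
      simp [linMap, smul_comm c]
    refine ⟨fun i => c • G i, fun i x => by simp [hG], fun x => ?_⟩
    simp only [Pi.smul_apply, ContinuousMap.smul_apply, hl]
    exact ⟨(h x).1.const_smul c, (h x).2.1.const_smul c, (h x).2.2.const_smul c⟩

/-- The map `g` represented by an element of `C2Space ρ`. -/
def toMap {ρ : ℝ} (g : C2Space ρ) (x : rect ρ) : R3 := g.1 0 x

/-- The partial derivative `g_y`. -/
def partialY {ρ : ℝ} (g : C2Space ρ) (x : rect ρ) : R3 := g.1 1 x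

/-- The partial derivative `g_z`. -/
def partialZ {ρ : ℝ} (g : C2Space ρ) (x : rect ρ) : R3 := g.1 2 x

/-- `g` is a regular injective `C²` parametrization of a surface whose boundary consists of the
two wires (the image of the edges `z = 0` and `z = ρ`) and of two curves on the cylinder (the image
of the edges `y = ±1`). -/
structure IsAdmissible (θ₀ ρ : ℝ) (g : C2Space ρ) : Prop where
  injective : Function.Injective (toMap g)
  immersion : ∀ x : rect ρ, LinearIndependent ℝ ![partialY g x, partialZ g x]
  wires_eq : toMap g '' wireEdges ρ = wires θ₀ ρ
  lateral_subset : toMap g '' lateralEdges ρ ⊆ cylinder ρ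

/-- The area element `|g_y × g_z|`, written through the Gram determinant of `g_y` and `g_z`. -/
def areaElement {ρ : ℝ} (g : C2Space ρ) (x : rect ρ) : ℝ :=
  Real.sqrt (‖partialY g x‖ ^ 2 * ‖partialZ g x‖ ^ 2 - inner ℝ (partialY g x) (partialZ g x) ^ 2)

/-- The free energy of the surface parametrized by `g`: its area times the surface tension `σ`. -/
def energy (σ : ℝ) {ρ : ℝ} (g : C2Space ρ) : ℝ := 
  ∫ x : rect ρ, σ * areaElement g x ∂(Measure.comap Subtype.val volume)

/-- The surface `S` satisfies the second-variation stability condition: the second derivative at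
`t = 0` of the energy is nonnegative along every one-parameter family `f` of admissible surfaces
that starts at `S` and is of class `C²` from an open interval around `0` into the space `C²`.
The initial velocities `v` of these families are the admissible ones. -/
def SecondVariationStable (σ θ₀ ρ : ℝ) (S : Set R3) : Prop :=
  ∀ (a b : ℝ) (f : ℝ → C2Space ρ), a < 0 → 0 < b →
    ContDiffOn ℝ 2 f (Ioo a b) →
    (∀ t ∈ Ioo a b, IsAdmissible θ₀ ρ (f t)) →
    range (toMap (f 0)) = S →
    0 ≤ iteratedDeriv 2 (fun t => energy σ (f t)) 0

end SoapFilm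

end

namespace SoapFilm

/-! Write `f 0 = (0, Y, Z)`, let `u` be the normal velocity (coordinate 0 of the velocity), and let
`j` be the Jacobian of `(Y, Z)`, whose sign `s` is constant. The parametrization `f 0` of the flat
film is arbitrary and is never inverted: every integral over the film is pulled back to the
rectangle as an integral of Jacobians.

Second variation. Differentiating the area element twice leaves a Dirichlet term, quadratic in the
derivatives of `u`, and the second derivative of the signed area of the `(Y, Z)` components. By
Green's formula the latter is a boundary term (`IsVariation.integral_jac₂`). The wires contribute
nothing to it. On the wall the constraint `X ^ 2 + Y ^ 2 = 1`, differentiated twice, forces the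
tangential acceleration to be `-Y u ^ 2`. In film coordinates the result is `σ` times the integral
of `|∇u| ^ 2` minus the integral of `u ^ 2` over the two lateral edges
(`IsVariation.iteratedDeriv_energy`), where `u = 0` on the wires.

Sufficiency. For `κ < π / ρ` the function `cosh (κ Y) sin (κ Z + δ)` is positive and harmonic on the
film. Its logarithmic gradient `(α, β)` has divergence `-(α ^ 2 + β ^ 2)`, so the divergence of `u ^
2 (α, β)` is at most `|∇u| ^ 2` (`picone_le`). Integrating and letting `κ` tend to `π / ρ` bounds
`(π / ρ) tanh (π / ρ)` times the edge term by the Dirichlet term (`IsVariation.edgeFlux_le`). As the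
edge term is nonnegative, stability follows.

Necessity. The explicit family `tilted` has `u = sin (k z) cosh (k y) / cosh k` with `k = π / ρ`,
and its second variation is a positive multiple of `k tanh k - 1`.

Critical length. The function `x tanh x` increases strictly on the positive axis and equals `1` at
some `κ` close to `1.2`, so `ρc = π / κ`. -/

/-- The retraction of the plane onto the rectangle. -/
noncomputable def clamp {ρ : ℝ} (hρ : 0 ≤ ρ) (p : ℝ × ℝ) : rect ρ :=
  ⟨(projIcc (-1) 1 (by norm_num) p.1, projIcc 0 ρ hρ p.2),
    ⟨(projIcc (-1) 1 (by norm_num) p.1).2, (projIcc 0 ρ hρ p.2).2⟩⟩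

/-! ### Integration over the closed rectangle -/

section Rectangle

variable {ρ : ℝ} (hρ : 0 ≤ ρ)

@[fun_prop]
theorem continuous_clamp : Continuous (clamp hρ) := by
  refine Continuous.subtype_mk (Continuous.prodMk ?_ ?_) _
  · exact continuous_subtype_val.comp (continuous_projIcc.comp continuous_fst)
  · exact continuous_subtype_val.comp (continuous_projIcc.comp continuous_snd)

theorem clamp_of_mem {p : ℝ × ℝ} (hp : p ∈ rect ρ) : clamp hρ p = ⟨p, hp⟩ := by
  apply Subtype.ext
  simp [clamp, projIcc_of_mem _ hp.1, projIcc_of_mem _ hp.2]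

@[simp]
theorem clamp_coe (x : rect ρ) : clamp hρ x.1 = x := clamp_of_mem hρ x.2

theorem clamp_fst_of_mem {s : ℝ} (hs : s ∈ Icc (-1 : ℝ) 1) (t : ℝ) :
    (clamp hρ (s, t)).1.1 = s := by
  simp [clamp, projIcc_of_mem _ hs]

theorem clamp_snd_of_mem {t : ℝ} (ht : t ∈ Icc 0 ρ) (s : ℝ) :
    (clamp hρ (s, t)).1.2 = t := by
  simp [clamp, projIcc_of_mem _ ht]

theorem clamp_one (t : ℝ) : (clamp hρ (1, t)).1.1 = 1 := clamp_fst_of_mem hρ (by simp) t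

theorem clamp_neg_one (t : ℝ) : (clamp hρ (-1, t)).1.1 = -1 := clamp_fst_of_mem hρ (by simp) t

theorem clamp_zero (s : ℝ) : (clamp hρ (s, 0)).1.2 = 0 := clamp_snd_of_mem hρ (by simp [hρ]) s

theorem clamp_top (s : ℝ) : (clamp hρ (s, ρ)).1.2 = ρ := clamp_snd_of_mem hρ (by simp [hρ]) s

theorem rect_eq_Icc (ρ : ℝ) : rect ρ = Icc ((-1, 0) : ℝ × ℝ) (1, ρ) := by
  simp [rect, Icc_prod_Icc]

theorem measurableSet_rect (ρ : ℝ) : MeasurableSet (rect ρ) :=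
  measurableSet_Icc.prod measurableSet_Icc

instance isFiniteMeasure_rect (ρ : ℝ) :
    IsFiniteMeasure (Measure.comap Subtype.val volume : Measure (rect ρ)) := by
  refine ⟨?_⟩
  rw [comap_subtype_coe_apply (measurableSet_rect ρ)]
  simp only [image_univ, Subtype.range_coe]
  exact (isCompact_Icc.prod isCompact_Icc).measure_lt_top

theorem integral_rect (F : rect ρ → ℝ) :
    ∫ x : rect ρ, F x ∂(Measure.comap Subtype.val volume) =
      ∫ p in Icc ((-1, 0) : ℝ × ℝ) (1, ρ), F (clamp hρ p) := by
  rw [← rect_eq_Icc, ← integral_subtype_comap (measurableSet_rect ρ) (fun p => F (clamp hρ p))]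
  simp

theorem integrable_rect {F : rect ρ → ℝ} (hF : Continuous F) :
    Integrable F (Measure.comap Subtype.val volume) :=
  hF.integrable_of_hasCompactSupport (HasCompactSupport.of_compactSpace F)

end Rectangle

/-! ### `C¹` functions up to the boundary and Green's formula -/

/-- The linear form on the plane with coefficients `a` and `b`. -/
noncomputable def linForm (a b : ℝ) : (ℝ × ℝ) →L[ℝ] ℝ :=
  a • ContinuousLinearMap.fst ℝ ℝ ℝ + b • ContinuousLinearMap.snd ℝ ℝ ℝ

@[simp]
theorem linForm_apply (a b : ℝ) (p : ℝ × ℝ) : linForm a b p = a * p.1 + b * p.2 := by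
  simp [linForm]

/-- `A` is a `C¹` function on the closed rectangle, with partial derivatives `Ay` and `Az`. -/
structure IsC1 {ρ : ℝ} (A Ay Az : rect ρ → ℝ) : Prop where
  cont : Continuous A
  contY : Continuous Ay
  contZ : Continuous Az
  grad : ∃ G : ℝ × ℝ → ℝ, (∀ x : rect ρ, G x = A x) ∧
    ∀ x : rect ρ, HasFDerivWithinAt G (linForm (Ay x) (Az x)) (rect ρ) x

namespace IsC1

variable {ρ : ℝ} {A Ay Az B By Bz : rect ρ → ℝ}

theorem mul (hA : IsC1 A Ay Az) (hB : IsC1 B By Bz) :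
    IsC1 (fun x => A x * B x) (fun x => Ay x * B x + A x * By x)
      (fun x => Az x * B x + A x * Bz x) := by
  obtain ⟨a1, a2, a3, G, hG, hG'⟩ := hA
  obtain ⟨b1, b2, b3, H, hH, hH'⟩ := hB
  refine ⟨by fun_prop, by fun_prop, by fun_prop, fun p => G p * H p, fun x => by simp [hG, hH],
    fun x => ((hG' x).mul (hH' x)).congr_fderiv ?_⟩
  ext <;> simp [hG, hH] <;> ring

theorem sq (hA : IsC1 A Ay Az) :
    IsC1 (fun x => A x ^ 2) (fun x => 2 * A x * Ay x) (fun x => 2 * A x * Az x) := by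
  convert hA.mul hA using 1 <;> ext x <;> ring

theorem comp (hA : IsC1 A Ay Az) {φ φ' : ℝ → ℝ} (hc : Continuous fun x => φ' (A x))
    (hφ : ∀ x, HasDerivAt φ (φ' (A x)) (A x)) :
    IsC1 (fun x => φ (A x)) (fun x => φ' (A x) * Ay x) (fun x => φ' (A x) * Az x) := by
  obtain ⟨a1, a2, a3, G, hG, hG'⟩ := hA
  refine ⟨?_, hc.mul a2, hc.mul a3, fun p => φ (G p), fun x => by simp [hG], fun x => ?_⟩
  · exact continuous_iff_continuousAt.2 fun x =>
      ContinuousAt.comp (f := A) (hφ x).continuousAt a1.continuousAt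
  · have h := hφ x
    rw [← hG x] at h
    refine (h.comp_hasFDerivWithinAt _ (hG' x)).congr_fderiv ?_
    ext <;> simp [hG]

theorem hasFDerivWithinAt (hρ : 0 ≤ ρ) (hA : IsC1 A Ay Az) (x : rect ρ) :
    HasFDerivWithinAt (fun p => A (clamp hρ p)) (linForm (Ay x) (Az x)) (rect ρ) x := by
  obtain ⟨G, hG, hG'⟩ := hA.grad
  refine (hG' x).congr (fun p hp => ?_) ?_
  · rw [clamp_of_mem hρ hp, ← hG]
  · simp [hG]

theorem hasDerivWithinAt_fst (hρ : 0 ≤ ρ) (hA : IsC1 A Ay Az) (x : rect ρ) :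
    HasDerivWithinAt (fun s => A (clamp hρ (s, x.1.2))) (Ay x) (Icc (-1) 1) x.1.1 := by
  have h1 : HasDerivWithinAt (fun s : ℝ => ((s, x.1.2) : ℝ × ℝ)) (1, 0) (Icc (-1) 1) x.1.1 :=
    (hasDerivWithinAt_id _ _).prodMk (hasDerivWithinAt_const _ _ _)
  have hm : MapsTo (fun s : ℝ => ((s, x.1.2) : ℝ × ℝ)) (Icc (-1) 1) (rect ρ) :=
    fun s hs => ⟨hs, x.2.2⟩
  have h2 := (hA.hasFDerivWithinAt hρ x).comp_hasDerivWithinAt (x.1.1 : ℝ) h1 hm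
  simp only [linForm_apply, mul_one, mul_zero, add_zero] at h2
  exact h2

theorem hasDerivWithinAt_snd (hρ : 0 ≤ ρ) (hA : IsC1 A Ay Az) (x : rect ρ) :
    HasDerivWithinAt (fun s => A (clamp hρ (x.1.1, s))) (Az x) (Icc 0 ρ) x.1.2 := by
  have h1 : HasDerivWithinAt (fun s : ℝ => ((x.1.1, s) : ℝ × ℝ)) (0, 1) (Icc 0 ρ) x.1.2 :=
    (hasDerivWithinAt_const _ _ _).prodMk (hasDerivWithinAt_id _ _)
  have hm : MapsTo (fun s : ℝ => ((x.1.1, s) : ℝ × ℝ)) (Icc 0 ρ) (rect ρ) :=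
    fun s hs => ⟨x.2.1, hs⟩
  have h2 := (hA.hasFDerivWithinAt hρ x).comp_hasDerivWithinAt (x.1.2 : ℝ) h1 hm
  simp only [linForm_apply, mul_one, mul_zero, zero_add] at h2
  exact h2

theorem partialY_eq_zero (hρ : 0 ≤ ρ) (hA : IsC1 A Ay Az) {c : ℝ} {x : rect ρ}
    (h : ∀ x' : rect ρ, x'.1.2 = x.1.2 → A x' = c) : Ay x = 0 := by
  have h1 := hA.hasDerivWithinAt_fst hρ x
  have h2 : HasDerivWithinAt (fun s => A (clamp hρ (s, x.1.2))) 0 (Icc (-1) 1) x.1.1 :=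
    (hasDerivWithinAt_const _ _ c).congr (fun s _ => h _ (clamp_snd_of_mem hρ x.2.2 s))
      (h _ (clamp_snd_of_mem hρ x.2.2 _))
  exact (uniqueDiffOn_Icc (by norm_num) _ x.2.1).eq_deriv _ h1 h2

theorem partialZ_eq_zero (hρ : 0 < ρ) (hA : IsC1 A Ay Az) {c : ℝ} {x : rect ρ}
    (h : ∀ x' : rect ρ, x'.1.1 = x.1.1 → A x' = c) : Az x = 0 := by
  have h1 := hA.hasDerivWithinAt_snd hρ.le x
  have h2 : HasDerivWithinAt (fun s => A (clamp hρ.le (x.1.1, s))) 0 (Icc 0 ρ) x.1.2 :=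
    (hasDerivWithinAt_const _ _ c).congr (fun s _ => h _ (clamp_fst_of_mem hρ.le x.2.1 s))
      (h _ (clamp_fst_of_mem hρ.le x.2.1 _))
  exact (uniqueDiffOn_Icc hρ _ x.2.2).eq_deriv _ h1 h2

/-- At a maximum the derivative in the direction `(-y, 0)`, which points into the rectangle, is at
most zero. -/
theorem partialY_mul_nonneg (hρ : 0 ≤ ρ) (hA : IsC1 A Ay Az) {x : rect ρ}
    (h : ∀ x', A x' ≤ A x) : 0 ≤ x.1.1 * Ay x := by
  have hmax : IsLocalMaxOn (fun p => A (clamp hρ p)) (rect ρ) x.1 := by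
    refine Filter.Eventually.of_forall fun p => ?_
    simpa using h _
  have hy : ((-x.1.1, 0) : ℝ × ℝ) ∈ posTangentConeAt (rect ρ) x.1 := by
    refine mem_posTangentConeAt_of_segment_subset
      (((convex_Icc _ _).prod (convex_Icc _ _)).segment_subset x.2 ⟨?_, ?_⟩)
    · simp
    · simpa using x.2.2
  have h1 := hmax.hasFDerivWithinAt_nonpos (hA.hasFDerivWithinAt hρ x) hy
  simp only [linForm_apply] at h1
  linarith

/-- The Jacobian is the divergence of `(A Bz, -A By)`, since the mixed derivatives `Byz` cancel.
Second derivatives are thus needed of `B` only. -/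
theorem integral_jacobian (hρ : 0 ≤ ρ) (hA : IsC1 A Ay Az) {Byy Byz Bzz : rect ρ → ℝ}
    (hBy : IsC1 By Byy Byz) (hBz : IsC1 Bz Byz Bzz) :
    ∫ x : rect ρ, (Ay x * Bz x - Az x * By x) ∂(Measure.comap Subtype.val volume) =
      (∫ z in (0 : ℝ)..ρ, A (clamp hρ (1, z)) * Bz (clamp hρ (1, z)))
      - (∫ z in (0 : ℝ)..ρ, A (clamp hρ (-1, z)) * Bz (clamp hρ (-1, z)))
      - (∫ y in (-1 : ℝ)..1, A (clamp hρ (y, ρ)) * By (clamp hρ (y, ρ)))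
      + ∫ y in (-1 : ℝ)..1, A (clamp hρ (y, 0)) * By (clamp hρ (y, 0)) := by
  rw [integral_rect hρ]
  have hP := hA.mul hBz
  have hR := hA.mul hBy
  have key := integral_divergence_prod_Icc_of_hasFDerivAt_off_countable_of_le
    (fun p => A (clamp hρ p) * Bz (clamp hρ p)) (fun p => -(A (clamp hρ p) * By (clamp hρ p)))
    (fun p => linForm (Ay (clamp hρ p) * Bz (clamp hρ p) + A (clamp hρ p) * Byz (clamp hρ p))
      (Az (clamp hρ p) * Bz (clamp hρ p) + A (clamp hρ p) * Bzz (clamp hρ p)))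
    (fun p => -linForm (Ay (clamp hρ p) * By (clamp hρ p) + A (clamp hρ p) * Byy (clamp hρ p))
      (Az (clamp hρ p) * By (clamp hρ p) + A (clamp hρ p) * Byz (clamp hρ p)))
    ((-1, 0) : ℝ × ℝ) (1, ρ) ⟨by norm_num, hρ⟩ ∅ countable_empty
    (hP.cont.comp (continuous_clamp hρ)).continuousOn
    (hR.cont.comp (continuous_clamp hρ)).neg.continuousOn
    ?_ ?_ ?_
  · simp only [neg_apply, linForm_apply, intervalIntegral.integral_neg] at key
    rw [show ∀ a b c d : ℝ, a - b - c + d = -c - -d + a - b by intros; ring, ← key]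
    congr 1; ext p; ring
  · rintro p ⟨⟨hp1, hp2⟩, -⟩
    have hp : p ∈ rect ρ := ⟨Ioo_subset_Icc_self hp1, Ioo_subset_Icc_self hp2⟩
    have hn : rect ρ ∈ nhds p := prod_mem_nhds (Icc_mem_nhds hp1.1 hp1.2) (Icc_mem_nhds hp2.1 hp2.2)
    simpa [clamp_of_mem hρ hp] using (hP.hasFDerivWithinAt hρ ⟨p, hp⟩).hasFDerivAt hn
  · rintro p ⟨⟨hp1, hp2⟩, -⟩
    have hp : p ∈ rect ρ := ⟨Ioo_subset_Icc_self hp1, Ioo_subset_Icc_self hp2⟩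
    have hn : rect ρ ∈ nhds p := prod_mem_nhds (Icc_mem_nhds hp1.1 hp1.2) (Icc_mem_nhds hp2.1 hp2.2)
    rw [clamp_of_mem hρ hp]
    exact ((hR.hasFDerivWithinAt hρ ⟨p, hp⟩).hasFDerivAt hn).fun_neg
  · refine ContinuousOn.integrableOn_Icc (Continuous.continuousOn ?_)
    obtain ⟨a1, a2, a3, -⟩ := hA
    obtain ⟨b1, b2, b3, -⟩ := hBy
    obtain ⟨c1, c2, c3, -⟩ := hBz
    simp only [neg_apply, linForm_apply]
    fun_prop

end IsC1

/-! ### Differentiation under the integral sign -/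

/-- Differentiation under the integral sign for integrands that are `C¹` in the parameter,
over a compact space. -/
theorem hasDerivAt_integral_of_continuousOn {K : Type*} [TopologicalSpace K] [CompactSpace K]
    [MeasurableSpace K] [BorelSpace K] (μ : Measure K) [IsFiniteMeasure μ]
    {a b : ℝ} {F F' : ℝ → K → ℝ}
    (hF : ContinuousOn (fun p : ℝ × K => F p.1 p.2) (Ioo a b ×ˢ univ))
    (hF' : ContinuousOn (fun p : ℝ × K => F' p.1 p.2) (Ioo a b ×ˢ univ))
    (h : ∀ t ∈ Ioo a b, ∀ x, HasDerivAt (fun t => F t x) (F' t x) t) {t₀ : ℝ}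
    (ht₀ : t₀ ∈ Ioo a b) :
    HasDerivAt (fun t => ∫ x, F t x ∂μ) (∫ x, F' t₀ x ∂μ) t₀ := by
  have hsec : ∀ {G : ℝ → K → ℝ}, ContinuousOn (fun p : ℝ × K => G p.1 p.2) (Ioo a b ×ˢ univ) →
      ∀ t ∈ Ioo a b, Continuous (G t) := by
    intro G hG t ht
    exact hG.comp_continuous (by fun_prop : Continuous fun x : K => (t, x))
      (fun x => ⟨ht, mem_univ x⟩)
  have hint : ∀ {g : K → ℝ}, Continuous g → Integrable g μ := fun hg =>
    hg.integrable_of_hasCompactSupport (HasCompactSupport.of_compactSpace _)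
  obtain ⟨c, d, hcd, hcdn, hcds⟩ := exists_Icc_mem_subset_of_mem_nhds (Ioo_mem_nhds ht₀.1 ht₀.2)
  obtain ⟨C, hC⟩ := (isCompact_Icc.prod (isCompact_univ (X := K))).exists_bound_of_continuousOn
    (hF'.mono (prod_mono hcds subset_rfl))
  refine (hasDerivAt_integral_of_dominated_loc_of_deriv_le (bound := fun _ => C)
    hcdn ?_ (hint (hsec hF t₀ ht₀)) (hint (hsec hF' t₀ ht₀)).aestronglyMeasurable ?_
    (integrable_const C) ?_).2
  · filter_upwards [Ioo_mem_nhds ht₀.1 ht₀.2] with t ht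
    exact (hint (hsec hF t ht)).aestronglyMeasurable
  · exact Filter.Eventually.of_forall fun x t ht => hC (t, x) ⟨ht, mem_univ x⟩
  · exact Filter.Eventually.of_forall fun x t ht => h t (hcds ht) x

theorem hasDerivAt_clm_apply {E : Type*} [NormedAddCommGroup E] [NormedSpace ℝ E] (L : E →L[ℝ] ℝ)
    {f : ℝ → E} {v : E} {t : ℝ} (h : HasDerivAt f v t) :
    HasDerivAt (fun t => L (f t)) (L v) t :=
  L.hasFDerivAt.comp_hasDerivAt t h

theorem continuousOn_of_hasDerivAt {E : Type*} [NormedAddCommGroup E] [NormedSpace ℝ E]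
    {f v : ℝ → E} {s : Set ℝ} (h : ∀ t ∈ s, HasDerivAt f (v t) t) : ContinuousOn f s :=
  fun t ht => (h t ht).continuousAt.continuousWithinAt

/-! ### The area element in terms of Jacobians -/

section Coordinates

variable {ρ : ℝ}

/-- The coordinate `k` of the `i`-th function among `g, g_y, g_z, g_yy, g_yz, g_zz`. -/
def coord (g : C2Space ρ) (i : Fin 6) (k : Fin 3) (x : rect ρ) : ℝ := g.1 i x k

theorem continuous_coord_uncurry (i : Fin 6) (k : Fin 3) :
    Continuous fun p : C2Space ρ × rect ρ => coord p.1 i k p.2 := by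
  unfold coord
  have h : Continuous fun p : C2Space ρ × rect ρ => p.1.1 i p.2 :=
    (((continuous_apply i).comp (continuous_subtype_val.comp continuous_fst)).eval continuous_snd)
  exact (EuclideanSpace.proj (𝕜 := ℝ) k).continuous.comp h

@[fun_prop]
theorem continuous_coord (g : C2Space ρ) (i : Fin 6) (k : Fin 3) : Continuous (coord g i k) :=
  (continuous_coord_uncurry i k).comp (by fun_prop : Continuous fun x : rect ρ => (g, x))

/-- Evaluation of a coordinate at a point, as a continuous linear form. -/
noncomputable def evalCoord (i : Fin 6) (k : Fin 3) (x : rect ρ) : C2Space ρ →L[ℝ] ℝ :=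
  (EuclideanSpace.proj (𝕜 := ℝ) k).comp ((ContinuousMap.evalCLM ℝ x).comp
    ((ContinuousLinearMap.proj i).comp (C2Space ρ).subtypeL))

theorem hasDerivAt_coord {f : ℝ → C2Space ρ} {v : C2Space ρ} {t : ℝ} (h : HasDerivAt f v t)
    (i : Fin 6) (k : Fin 3) (x : rect ρ) :
    HasDerivAt (fun t => coord (f t) i k x) (coord v i k x) t :=
  hasDerivAt_clm_apply (E := C2Space ρ) (evalCoord i k x) h

theorem proj_comp_linMap (a b : R3) (k : Fin 3) :
    (EuclideanSpace.proj (𝕜 := ℝ) k).comp (linMap a b) = linForm (a k) (b k) := by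
  ext <;> simp [linMap]

theorem isC1_coord_aux (g : C2Space ρ) {i j l : Fin 6} (k : Fin 3)
    (h : ∃ G : ℝ × ℝ → R3, (∀ x : rect ρ, G x = g.1 i x) ∧
      ∀ x : rect ρ, HasFDerivWithinAt G (linMap (g.1 j x) (g.1 l x)) (rect ρ) x) :
    IsC1 (coord g i k) (coord g j k) (coord g l k) := by
  obtain ⟨G, hG, h⟩ := h
  refine ⟨by fun_prop, by fun_prop, by fun_prop, fun p => G p k,
    fun x => by simp [hG, coord], fun x => ?_⟩
  have := (EuclideanSpace.proj (𝕜 := ℝ) k).hasFDerivAt.comp_hasFDerivWithinAt _ (h x)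
  rw [proj_comp_linMap] at this
  exact this

theorem isC1_coord (g : C2Space ρ) (k : Fin 3) :
    IsC1 (coord g 0 k) (coord g 1 k) (coord g 2 k) := by
  obtain ⟨G, hG, h⟩ := g.2
  exact isC1_coord_aux g k ⟨G 0, hG 0, fun x => (h x).1⟩

theorem isC1_coord_partialY (g : C2Space ρ) (k : Fin 3) :
    IsC1 (coord g 1 k) (coord g 3 k) (coord g 4 k) := by
  obtain ⟨G, hG, h⟩ := g.2
  exact isC1_coord_aux g k ⟨G 1, hG 1, fun x => (h x).2.1⟩

theorem isC1_coord_partialZ (g : C2Space ρ) (k : Fin 3) :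
    IsC1 (coord g 2 k) (coord g 4 k) (coord g 5 k) := by
  obtain ⟨G, hG, h⟩ := g.2
  exact isC1_coord_aux g k ⟨G 2, hG 2, fun x => (h x).2.2⟩

/-- The Jacobian determinant of the coordinate `k` of `g` and the coordinate `l` of `h`. -/
def jac (g h : C2Space ρ) (k l : Fin 3) (x : rect ρ) : ℝ :=
  coord g 1 k x * coord h 2 l x - coord g 2 k x * coord h 1 l x

@[fun_prop]
theorem continuous_jac (g h : C2Space ρ) (k l : Fin 3) : Continuous (jac g h k l) := by
  unfold jac; fun_prop

theorem hasDerivAt_jac {f h : ℝ → C2Space ρ} {v w : C2Space ρ} {t : ℝ} (hf : HasDerivAt f v t)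
    (hh : HasDerivAt h w t) (k l : Fin 3) (x : rect ρ) :
    HasDerivAt (fun t => jac (f t) (h t) k l x) (jac v (h t) k l x + jac (f t) w k l x) t := by
  unfold jac
  refine (((hasDerivAt_coord hf 1 k x).mul (hasDerivAt_coord hh 2 l x)).sub
    ((hasDerivAt_coord hf 2 k x).mul (hasDerivAt_coord hh 1 l x))).congr_deriv ?_
  ring

theorem continuousOn_jac {f h : ℝ → C2Space ρ} {s : Set ℝ} (hf : ContinuousOn f s)
    (hh : ContinuousOn h s) (k l : Fin 3) :
    ContinuousOn (fun p : ℝ × rect ρ => jac (f p.1) (h p.1) k l p.2) (s ×ˢ univ) := by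
  have key : ∀ {f : ℝ → C2Space ρ}, ContinuousOn f s → ∀ (i : Fin 6) (k : Fin 3),
      ContinuousOn (fun p : ℝ × rect ρ => coord (f p.1) i k p.2) (s ×ˢ univ) := by
    intro f hf i k
    refine (continuous_coord_uncurry i k).comp_continuousOn
      (f := fun p : ℝ × rect ρ => (f p.1, p.2)) (ContinuousOn.prodMk ?_ continuousOn_snd)
    exact hf.comp continuousOn_fst fun p hp => hp.1
  unfold jac
  exact ((key hf 1 k).mul (key hh 2 l)).sub ((key hf 2 k).mul (key hh 1 l))

/-- The square of the area element, as the squared norm of the cross product. -/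
def gramDet (g : C2Space ρ) (x : rect ρ) : ℝ :=
  jac g g 1 2 x ^ 2 + jac g g 0 1 x ^ 2 + jac g g 0 2 x ^ 2

theorem gramDet_eq (g : C2Space ρ) (x : rect ρ) :
    ‖partialY g x‖ ^ 2 * ‖partialZ g x‖ ^ 2 - inner ℝ (partialY g x) (partialZ g x) ^ 2 =
      gramDet g x := by
  simp only [EuclideanSpace.norm_sq_eq, PiLp.inner_apply, Fin.sum_univ_three, gramDet, jac, coord,
    partialY, partialZ, Real.norm_eq_abs, sq_abs, RCLike.inner_apply, conj_trivial]
  ring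

theorem areaElement_eq (g : C2Space ρ) (x : rect ρ) :
    areaElement g x = Real.sqrt (gramDet g x) := by
  rw [areaElement, gramDet_eq]

/-- With `a = g_y` and `b = g_z`, the vector `|b|² a - ⟨a, b⟩ b` has squared norm `|b|²` times the
Gram determinant; if this vanishes, it is a linear relation whose first coefficient is nonzero. -/
theorem gramDet_pos {g : C2Space ρ} {x : rect ρ}
    (h : LinearIndependent ℝ ![partialY g x, partialZ g x]) : 0 < gramDet g x := by
  have hb : partialZ g x ≠ 0 := h.ne_zero 1
  rw [LinearIndependent.pair_iff] at h
  refine lt_of_le_of_ne (by unfold gramDet; positivity) fun h0 => hb ?_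
  rw [← gramDet_eq] at h0
  have key : ‖(‖partialZ g x‖ ^ 2) • partialY g x +
      (-inner ℝ (partialY g x) (partialZ g x)) • partialZ g x‖ ^ 2 = 0 := by
    rw [@norm_add_sq_real, norm_smul, norm_smul, inner_smul_left, inner_smul_right]
    simp only [norm_pow, norm_neg, Real.norm_eq_abs, mul_pow, sq_abs, conj_trivial]
    linear_combination (-‖partialZ g x‖ ^ 2) * h0
  have := (h _ _ (norm_eq_zero.1 (pow_eq_zero_iff two_ne_zero |>.1 key))).1
  simpa using this

/-- The first derivative of the square of the area element along a curve, from the value `g` and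
the velocity `v`. -/
def gramDet₁ (g v : C2Space ρ) (x : rect ρ) : ℝ :=
  2 * (jac g g 1 2 x * (jac v g 1 2 x + jac g v 1 2 x)
    + jac g g 0 1 x * (jac v g 0 1 x + jac g v 0 1 x)
    + jac g g 0 2 x * (jac v g 0 2 x + jac g v 0 2 x))

/-- The second derivative of a Jacobian along a curve, from the value `g`, the velocity `v` and the
acceleration `w`. -/
def jac₂ (g v w : C2Space ρ) (k l : Fin 3) (x : rect ρ) : ℝ :=
  jac w g k l x + 2 * jac v v k l x + jac g w k l x

/-- The second derivative of the square of the area element along a curve. -/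
def gramDet₂ (g v w : C2Space ρ) (x : rect ρ) : ℝ :=
  2 * ((jac v g 1 2 x + jac g v 1 2 x) ^ 2 + jac g g 1 2 x * jac₂ g v w 1 2 x
    + ((jac v g 0 1 x + jac g v 0 1 x) ^ 2 + jac g g 0 1 x * jac₂ g v w 0 1 x)
    + ((jac v g 0 2 x + jac g v 0 2 x) ^ 2 + jac g g 0 2 x * jac₂ g v w 0 2 x))

theorem hasDerivAt_gramDet {f : ℝ → C2Space ρ} {v : C2Space ρ} {t : ℝ} (hf : HasDerivAt f v t)
    (x : rect ρ) : HasDerivAt (fun t => gramDet (f t) x) (gramDet₁ (f t) v x) t := by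
  unfold gramDet gramDet₁
  refine ((((hasDerivAt_jac hf hf 1 2 x).pow 2).add ((hasDerivAt_jac hf hf 0 1 x).pow 2)).add
    ((hasDerivAt_jac hf hf 0 2 x).pow 2)).congr_deriv ?_
  push_cast
  ring

theorem hasDerivAt_gramDet₁ {f v : ℝ → C2Space ρ} {w : C2Space ρ} {t : ℝ}
    (hf : HasDerivAt f (v t) t) (hv : HasDerivAt v w t) (x : rect ρ) :
    HasDerivAt (fun t => gramDet₁ (f t) (v t) x) (gramDet₂ (f t) (v t) w x) t := by
  unfold gramDet₁ gramDet₂ jac₂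
  have key : ∀ k l : Fin 3, HasDerivAt
      (fun t => jac (f t) (f t) k l x * (jac (v t) (f t) k l x + jac (f t) (v t) k l x))
      ((jac (v t) (f t) k l x + jac (f t) (v t) k l x) ^ 2 + jac (f t) (f t) k l x *
        (jac w (f t) k l x + 2 * jac (v t) (v t) k l x + jac (f t) w k l x)) t := by
    intro k l
    refine ((hasDerivAt_jac hf hf k l x).mul
      ((hasDerivAt_jac hv hf k l x).add (hasDerivAt_jac hf hv k l x))).congr_deriv ?_
    simp only [Pi.add_apply]
    ring
  exact (((key 1 2).add (key 0 1)).add (key 0 2)).const_mul 2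

end Coordinates

/-! ### The second derivative of the energy along a curve of immersions -/

/-- The second derivative of the square root of a function with positive value `d`, and first and
second derivatives `d₁` and `d₂`. -/
noncomputable def sqrtDeriv₂ (d d₁ d₂ : ℝ) : ℝ :=
  d₂ / (2 * Real.sqrt d) - d₁ ^ 2 / (4 * d * Real.sqrt d)

theorem hasDerivAt_sqrtDeriv {φ φ₁ : ℝ → ℝ} {φ₂ t : ℝ} (h0 : 0 < φ t)
    (h : HasDerivAt φ (φ₁ t) t) (h1 : HasDerivAt φ₁ φ₂ t) :
    HasDerivAt (fun t => φ₁ t / (2 * Real.sqrt (φ t))) (sqrtDeriv₂ (φ t) (φ₁ t) φ₂) t := by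
  have hs := Real.sqrt_pos.2 h0
  refine (h1.div ((h.sqrt h0.ne').const_mul 2) (by positivity)).congr_deriv ?_
  unfold sqrtDeriv₂
  have hsq := Real.sq_sqrt h0.le
  set s := Real.sqrt (φ t)
  rw [← hsq]
  field_simp
  ring

/-- The second derivative of the energy along a curve of immersions. -/
theorem iteratedDeriv_energy {ρ σ a b : ℝ} {f v w : ℝ → C2Space ρ} (ha : a < 0) (hb : 0 < b)
    (hv : ∀ t ∈ Ioo a b, HasDerivAt f (v t) t) (hw : ∀ t ∈ Ioo a b, HasDerivAt v (w t) t)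
    (hwc : ContinuousOn w (Ioo a b))
    (himm : ∀ t ∈ Ioo a b, ∀ x, LinearIndependent ℝ ![partialY (f t) x, partialZ (f t) x]) :
    iteratedDeriv 2 (fun t => energy σ (f t)) 0 =
      ∫ x : rect ρ, σ * sqrtDeriv₂ (gramDet (f 0) x) (gramDet₁ (f 0) (v 0) x)
        (gramDet₂ (f 0) (v 0) (w 0) x) ∂(Measure.comap Subtype.val volume) := by
  have hfc : ContinuousOn f (Ioo a b) := continuousOn_of_hasDerivAt (E := C2Space ρ) hv
  have hvc : ContinuousOn v (Ioo a b) := continuousOn_of_hasDerivAt (E := C2Space ρ) hw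
  have hpos : ∀ t ∈ Ioo a b, ∀ x, 0 < gramDet (f t) x := fun t ht x => gramDet_pos (himm t ht x)
  have hff := fun k l => continuousOn_jac hfc hfc k l
  have hfv := fun k l => continuousOn_jac hfc hvc k l
  have hvf := fun k l => continuousOn_jac hvc hfc k l
  have hvv := fun k l => continuousOn_jac hvc hvc k l
  have hfw := fun k l => continuousOn_jac hfc hwc k l
  have hwf := fun k l => continuousOn_jac hwc hfc k l
  have c0 : ContinuousOn (fun p : ℝ × rect ρ => gramDet (f p.1) p.2) (Ioo a b ×ˢ univ) := by
    exact (((hff 1 2).pow 2).add ((hff 0 1).pow 2)).add ((hff 0 2).pow 2)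
  have c1 : ContinuousOn (fun p : ℝ × rect ρ => gramDet₁ (f p.1) (v p.1) p.2)
      (Ioo a b ×ˢ univ) := by
    have h := fun k l => (hff k l).mul ((hvf k l).add (hfv k l))
    exact continuousOn_const.mul (((h 1 2).add (h 0 1)).add (h 0 2))
  have c2 : ContinuousOn (fun p : ℝ × rect ρ => gramDet₂ (f p.1) (v p.1) (w p.1) p.2)
      (Ioo a b ×ˢ univ) := by
    have h := fun k l => (((hvf k l).add (hfv k l)).pow 2).add ((hff k l).mul
      (((hwf k l).add ((continuousOn_const (c := (2 : ℝ))).mul (hvv k l))).add (hfw k l)))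
    exact continuousOn_const.mul (((h 1 2).add (h 0 1)).add (h 0 2))
  have cs := c0.sqrt
  have hpos' : ∀ p ∈ (Ioo a b ×ˢ univ : Set (ℝ × rect ρ)), 0 < gramDet (f p.1) p.2 :=
    fun p hp => hpos p.1 hp.1 p.2
  have d1 : ∀ t ∈ Ioo a b, HasDerivAt (fun t => energy σ (f t))
      (∫ x : rect ρ, σ * (gramDet₁ (f t) (v t) x / (2 * Real.sqrt (gramDet (f t) x)))
        ∂(Measure.comap Subtype.val volume)) t := by
    intro t ht
    unfold energy
    simp only [areaElement_eq]
    refine hasDerivAt_integral_of_continuousOn _ (F := fun t x => σ * Real.sqrt (gramDet (f t) x))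
      (F' := fun t x => σ * (gramDet₁ (f t) (v t) x / (2 * Real.sqrt (gramDet (f t) x))))
      (continuousOn_const.mul cs) (continuousOn_const.mul (c1.div (continuousOn_const.mul cs) ?_))
      ?_ ht
    · intro p hp
      exact (mul_pos two_pos (Real.sqrt_pos.2 (hpos' p hp))).ne'
    · intro t ht x
      exact ((hasDerivAt_gramDet (hv t ht) x).sqrt (hpos t ht x).ne').const_mul σ
  have d2 : HasDerivAt (fun t => ∫ x : rect ρ,
      σ * (gramDet₁ (f t) (v t) x / (2 * Real.sqrt (gramDet (f t) x)))
        ∂(Measure.comap Subtype.val volume))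
      (∫ x : rect ρ, σ * sqrtDeriv₂ (gramDet (f 0) x) (gramDet₁ (f 0) (v 0) x)
        (gramDet₂ (f 0) (v 0) (w 0) x) ∂(Measure.comap Subtype.val volume)) 0 := by
    refine hasDerivAt_integral_of_continuousOn (a := a) (b := b) _
      (F := fun t x => σ * (gramDet₁ (f t) (v t) x / (2 * Real.sqrt (gramDet (f t) x))))
      (F' := fun t x => σ * sqrtDeriv₂ (gramDet (f t) x) (gramDet₁ (f t) (v t) x)
        (gramDet₂ (f t) (v t) (w t) x))
      (continuousOn_const.mul (c1.div (continuousOn_const.mul cs) ?_))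
      (continuousOn_const.mul ((c2.div (continuousOn_const.mul cs) ?_).sub
        ((c1.pow 2).div ((continuousOn_const.mul c0).mul cs) ?_))) ?_ ⟨ha, hb⟩
    · intro p hp
      exact (mul_pos two_pos (Real.sqrt_pos.2 (hpos' p hp))).ne'
    · intro p hp
      exact (mul_pos two_pos (Real.sqrt_pos.2 (hpos' p hp))).ne'
    · intro p hp
      exact (mul_pos (mul_pos four_pos (hpos' p hp)) (Real.sqrt_pos.2 (hpos' p hp))).ne'
    · intro t ht x
      exact (hasDerivAt_sqrtDeriv (φ := fun t => gramDet (f t) x)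
        (φ₁ := fun t => gramDet₁ (f t) (v t) x) (hpos t ht x) (hasDerivAt_gramDet (hv t ht) x)
        (hasDerivAt_gramDet₁ (hv t ht) (hw t ht) x)).const_mul σ
  rw [iteratedDeriv_succ, iteratedDeriv_one]
  refine (d2.congr_of_eventuallyEq ?_).deriv
  filter_upwards [Ioo_mem_nhds ha hb] with t ht
  exact (d1 t ht).deriv

/-! ### Boundary constraints on admissible families -/

/-- A one-parameter family `f` of admissible surfaces starting at the flat film, with velocity `v`
and acceleration `w`. -/
structure IsVariation (ρ a b : ℝ) (f v w : ℝ → C2Space ρ) : Prop where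
  neg : a < 0
  pos : 0 < b
  velocity : ∀ t ∈ Ioo a b, HasDerivAt f (v t) t
  acceleration : ∀ t ∈ Ioo a b, HasDerivAt v (w t) t
  continuousOn_acceleration : ContinuousOn w (Ioo a b)
  admissible : ∀ t ∈ Ioo a b, IsAdmissible 0 ρ (f t)
  range_eq : range (toMap (f 0)) = flatFilm ρ

theorem eq_zero_of_hasDerivAt_of_const {a b c t φ' : ℝ} {φ : ℝ → ℝ} (h : HasDerivAt φ φ' t)
    (ht : t ∈ Ioo a b) (hc : ∀ s ∈ Ioo a b, φ s = c) : φ' = 0 := by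
  refine h.unique ((hasDerivAt_const t c).congr_of_eventuallyEq ?_)
  filter_upwards [Ioo_mem_nhds ht.1 ht.2] with s hs using hc s hs

section Admissible

variable {ρ : ℝ} {g : C2Space ρ}

/-- Only the image of the union of both edges is prescribed. The relation `Z (Z - ρ) = 0` holds on
either wire, so it need not be known which edge is sent where. -/
theorem IsAdmissible.coord_wires (hg : IsAdmissible 0 ρ g) {x : rect ρ} (hx : x ∈ wireEdges ρ) :
    coord g 0 0 x = 0 ∧ coord g 0 2 x * (coord g 0 2 x - ρ) = 0 := by
  have h : toMap g x ∈ wires 0 ρ := hg.wires_eq ▸ mem_image_of_mem _ hx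
  change toMap g x 0 = 0 ∧ toMap g x 2 * (toMap g x 2 - ρ) = 0
  rcases h with ⟨s, -, -, h⟩ | ⟨s, -, -, h⟩ <;> simp [h]

theorem IsAdmissible.coord_lateral (hρ : 0 < ρ) (hg : IsAdmissible 0 ρ g) {x : rect ρ}
    (hx : x.1.1 = -1 ∨ x.1.1 = 1) : coord g 0 0 x ^ 2 + coord g 0 1 x ^ 2 = 1 := by
  let F : ℝ → ℝ := fun s => coord g 0 0 (clamp hρ.le (x.1.1, s)) ^ 2 +
    coord g 0 1 (clamp hρ.le (x.1.1, s)) ^ 2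
  have hF : Continuous F := by
    have h : Continuous fun s : ℝ => clamp hρ.le (x.1.1, s) := by fun_prop
    exact (((continuous_coord g 0 0).comp h).pow 2).add (((continuous_coord g 0 1).comp h).pow 2)
  have h1 : EqOn F (fun _ => 1) (Ioo 0 ρ) := by
    intro s hs
    have hm : clamp hρ.le (x.1.1, s) ∈ lateralEdges ρ := by
      refine ⟨?_, ?_⟩
      · rwa [clamp_fst_of_mem hρ.le x.2.1]
      · rwa [clamp_snd_of_mem hρ.le (Ioo_subset_Icc_self hs)]
    exact (hg.lateral_subset (mem_image_of_mem _ hm)).1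
  have h2 := h1.closure hF continuous_const
  rw [closure_Ioo hρ.ne] at h2
  simpa [F] using h2 x.2.2

/-- Differentiating `Z (Z - ρ) = 0` along the edge gives `(2 Z - ρ) Z_y = 0`, and `2 Z - ρ` is `ρ`
or `-ρ`. -/
theorem IsAdmissible.partialY_coord_wires (hρ : 0 < ρ) (hg : IsAdmissible 0 ρ g) {x : rect ρ}
    (hx : x ∈ wireEdges ρ) : coord g 1 2 x = 0 := by
  have h1 : IsC1 _ _ _ := (isC1_coord g 2).comp (φ := fun s => s * (s - ρ))
    (φ' := fun s => 2 * s - ρ) (by fun_prop)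
    (fun x => ((hasDerivAt_id _).mul ((hasDerivAt_id _).sub_const ρ)).congr_deriv
      (by simp only [id]; ring))
  have h2 := h1.partialY_eq_zero hρ.le (c := 0) (x := x) fun x' hx' =>
    (hg.coord_wires (by simpa [wireEdges, hx'] using hx)).2
  have h3 := (hg.coord_wires hx).2
  rcases mul_eq_zero.1 h2 with h | h
  · nlinarith
  · exact h

end Admissible

namespace IsVariation

variable {ρ a b : ℝ} {f v w : ℝ → C2Space ρ} (hf : IsVariation ρ a b f v w) {x : rect ρ}
include hf

theorem zero_mem : (0 : ℝ) ∈ Ioo a b := ⟨hf.neg, hf.pos⟩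

theorem coord_mem (x : rect ρ) : coord (f 0) 0 0 x = 0 ∧ coord (f 0) 0 1 x ^ 2 ≤ 1 ∧
    0 ≤ coord (f 0) 0 2 x ∧ coord (f 0) 0 2 x ≤ ρ := by
  have h : toMap (f 0) x ∈ flatFilm ρ := hf.range_eq ▸ mem_range_self x
  obtain ⟨h1, ⟨h2, h3⟩, h4⟩ := h
  exact ⟨h1, by change toMap (f 0) x 1 ^ 2 ≤ 1; nlinarith, h4⟩

theorem coord_partial (hρ : 0 < ρ) (x : rect ρ) :
    coord (f 0) 1 0 x = 0 ∧ coord (f 0) 2 0 x = 0 :=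
  ⟨(isC1_coord (f 0) 0).partialY_eq_zero hρ.le fun x' _ => (hf.coord_mem x').1,
    (isC1_coord (f 0) 0).partialZ_eq_zero hρ fun x' _ => (hf.coord_mem x').1⟩

theorem velocity_wires (hρ : 0 < ρ) {t : ℝ} (ht : t ∈ Ioo a b) (hx : x ∈ wireEdges ρ) :
    coord (v t) 0 0 x = 0 ∧ coord (v t) 0 2 x = 0 := by
  have h0 := hasDerivAt_coord (hf.velocity t ht) 0 0 x
  have h2 := hasDerivAt_coord (hf.velocity t ht) 0 2 x
  refine ⟨eq_zero_of_hasDerivAt_of_const h0 ht fun s hs =>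
    ((hf.admissible s hs).coord_wires hx).1, ?_⟩
  have h3 := eq_zero_of_hasDerivAt_of_const (h2.mul (h2.sub_const ρ)) ht fun s hs =>
    ((hf.admissible s hs).coord_wires hx).2
  have h4 := ((hf.admissible t ht).coord_wires hx).2
  rcases mul_eq_zero.1 h4 with h | h
  · simpa [h, hρ.ne'] using h3
  · simpa [sub_eq_zero.1 h, hρ.ne'] using h3

theorem acceleration_wires (hρ : 0 < ρ) (hx : x ∈ wireEdges ρ) : coord (w 0) 0 2 x = 0 :=
  eq_zero_of_hasDerivAt_of_const (hasDerivAt_coord (hf.acceleration 0 hf.zero_mem) 0 2 x)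
    hf.zero_mem fun _ hs => (hf.velocity_wires hρ hs hx).2

theorem partialY_velocity_wires (hρ : 0 < ρ) (hx : x ∈ wireEdges ρ) : coord (v 0) 1 2 x = 0 :=
  (isC1_coord (v 0) 2).partialY_eq_zero hρ.le fun x' hx' =>
    (hf.velocity_wires hρ hf.zero_mem (x := x') (by simpa [wireEdges, hx'] using hx)).2

theorem coord_lateral (hρ : 0 < ρ) (hx : x.1.1 = -1 ∨ x.1.1 = 1) :
    coord (f 0) 0 1 x ^ 2 = 1 := by
  have h := (hf.admissible 0 hf.zero_mem).coord_lateral hρ hx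
  rwa [(hf.coord_mem x).1, zero_pow two_ne_zero, zero_add] at h

theorem partialZ_coord_lateral (hρ : 0 < ρ) (hx : x.1.1 = -1 ∨ x.1.1 = 1) :
    coord (f 0) 2 1 x = 0 := by
  have h := (isC1_coord (f 0) 1).sq.partialZ_eq_zero hρ (x := x) fun x' hx' =>
    hf.coord_lateral hρ (by rwa [hx'])
  have h1 := hf.coord_lateral hρ hx
  have h2 : coord (f 0) 0 1 x ≠ 0 := fun h0 => by simp [h0] at h1
  simpa [h2] using h

theorem velocity_lateral (hρ : 0 < ρ) (hx : x.1.1 = -1 ∨ x.1.1 = 1) {t : ℝ} (ht : t ∈ Ioo a b) :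
    coord (f t) 0 0 x * coord (v t) 0 0 x + coord (f t) 0 1 x * coord (v t) 0 1 x = 0 := by
  have h := eq_zero_of_hasDerivAt_of_const (((hasDerivAt_coord (hf.velocity t ht) 0 0 x).pow 2).add
    ((hasDerivAt_coord (hf.velocity t ht) 0 1 x).pow 2)) ht fun s hs =>
    (hf.admissible s hs).coord_lateral hρ hx
  norm_num at h
  linarith

theorem velocity_lateral_zero (hρ : 0 < ρ) (hx : x.1.1 = -1 ∨ x.1.1 = 1) :
    coord (v 0) 0 1 x = 0 := by
  have h := hf.velocity_lateral hρ hx hf.zero_mem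
  have h1 := hf.coord_lateral hρ hx
  have h2 : coord (f 0) 0 1 x ≠ 0 := fun h0 => by simp [h0] at h1
  simpa [(hf.coord_mem x).1, h2] using h

/-- This is the curvature of the wall: the second time derivative of `X ^ 2 + Y ^ 2 = 1`, at `X = 0`
and with `Y' = 0`, reads `X' ^ 2 + Y Y'' = 0`, and `Y ^ 2 = 1`. -/
theorem acceleration_lateral (hρ : 0 < ρ) (hx : x.1.1 = -1 ∨ x.1.1 = 1) :
    coord (w 0) 0 1 x = -(coord (f 0) 0 1 x * coord (v 0) 0 0 x ^ 2) := by
  have hd := fun k => hasDerivAt_coord (hf.velocity 0 hf.zero_mem) 0 k x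
  have hd' := fun k => hasDerivAt_coord (hf.acceleration 0 hf.zero_mem) 0 k x
  have h := eq_zero_of_hasDerivAt_of_const (((hd 0).mul (hd' 0)).add ((hd 1).mul (hd' 1)))
    hf.zero_mem fun s hs => hf.velocity_lateral hρ hx hs
  rw [(hf.coord_mem x).1, hf.velocity_lateral_zero hρ hx] at h
  linear_combination coord (f 0) 0 1 x * h - coord (w 0) 0 1 x * hf.coord_lateral hρ hx

end IsVariation

/-! ### The second variation as a quadratic form in the normal velocity -/

/-- The difference of the integrals of a function over the edges `y = 1` and `y = -1`. -/
noncomputable def edgeFlux {ρ : ℝ} (hρ : 0 ≤ ρ) (A : rect ρ → ℝ) : ℝ :=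
  (∫ z in (0 : ℝ)..ρ, A (clamp hρ (1, z))) - ∫ z in (0 : ℝ)..ρ, A (clamp hρ (-1, z))

theorem edgeFlux_congr {ρ : ℝ} (hρ : 0 ≤ ρ) {A B : rect ρ → ℝ}
    (h : ∀ x : rect ρ, x.1.1 = -1 ∨ x.1.1 = 1 → A x = B x) : edgeFlux hρ A = edgeFlux hρ B := by
  unfold edgeFlux
  simp only [h _ (.inr (clamp_one hρ _)), h _ (.inl (clamp_neg_one hρ _))]

theorem edgeFlux_const_mul {ρ : ℝ} (hρ : 0 ≤ ρ) (c : ℝ) (A : rect ρ → ℝ) :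
    edgeFlux hρ (fun x => c * A x) = c * edgeFlux hρ A := by
  unfold edgeFlux
  simp only [intervalIntegral.integral_const_mul, mul_sub]

/-- Green's formula, when nothing flows through the edges `z = 0` and `z = ρ`. -/
theorem IsC1.integral_jacobian_eq_edgeFlux {ρ : ℝ} (hρ : 0 ≤ ρ)
    {A Ay Az By Bz Byy Byz Bzz : rect ρ → ℝ} (hA : IsC1 A Ay Az)
    (hBy : IsC1 By Byy Byz) (hBz : IsC1 Bz Byz Bzz)
    (h : ∀ x ∈ wireEdges ρ, A x * By x = 0) :
    ∫ x : rect ρ, (Ay x * Bz x - Az x * By x) ∂(Measure.comap Subtype.val volume) =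
      edgeFlux hρ fun x => A x * Bz x := by
  rw [hA.integral_jacobian hρ hBy hBz, edgeFlux]
  simp [h _ (.inl (clamp_zero hρ _)), h _ (.inr (clamp_top hρ _))]

namespace IsVariation

variable {ρ a b : ℝ} {f v w : ℝ → C2Space ρ} (hf : IsVariation ρ a b f v w)
include hf

/-- The first-order part of the energy, up to second order, is determined by the displacement of
the lateral edges along the cylinder. -/
theorem integral_jac₂ (hρ : 0 < ρ) :
    ∫ x : rect ρ, jac₂ (f 0) (v 0) (w 0) 1 2 x ∂(Measure.comap Subtype.val volume) =
      -edgeFlux hρ.le fun x => coord (v 0) 0 0 x ^ 2 * (coord (f 0) 0 1 x * coord (f 0) 2 2 x) := by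
  have i1 : ∫ x : rect ρ, jac (w 0) (f 0) 1 2 x ∂(Measure.comap Subtype.val volume) =
      -edgeFlux hρ.le fun x =>
        coord (v 0) 0 0 x ^ 2 * (coord (f 0) 0 1 x * coord (f 0) 2 2 x) := by
    rw [← neg_one_mul, ← edgeFlux_const_mul]
    refine ((isC1_coord (w 0) 1).integral_jacobian_eq_edgeFlux hρ.le (isC1_coord_partialY (f 0) 2)
      (isC1_coord_partialZ (f 0) 2) fun x hx => ?_).trans (edgeFlux_congr _ fun x hx => ?_)
    · rw [(hf.admissible 0 hf.zero_mem).partialY_coord_wires hρ hx, mul_zero]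
    · rw [hf.acceleration_lateral hρ hx]; ring
  have i2 : ∫ x : rect ρ, jac (v 0) (v 0) 1 2 x ∂(Measure.comap Subtype.val volume) = 0 := by
    refine ((isC1_coord (v 0) 1).integral_jacobian_eq_edgeFlux hρ.le (isC1_coord_partialY (v 0) 2)
      (isC1_coord_partialZ (v 0) 2) fun x hx => ?_).trans
      ((edgeFlux_congr (B := fun _ => 0) _ fun x hx => ?_).trans (by simp [edgeFlux]))
    · rw [hf.partialY_velocity_wires hρ hx, mul_zero]
    · rw [hf.velocity_lateral_zero hρ hx, zero_mul]
  have i3 : ∫ x : rect ρ, jac (w 0) (f 0) 2 1 x ∂(Measure.comap Subtype.val volume) = 0 := by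
    refine ((isC1_coord (w 0) 2).integral_jacobian_eq_edgeFlux hρ.le (isC1_coord_partialY (f 0) 1)
      (isC1_coord_partialZ (f 0) 1) fun x hx => ?_).trans
      ((edgeFlux_congr (B := fun _ => 0) _ fun x hx => ?_).trans (by simp [edgeFlux]))
    · rw [hf.acceleration_wires hρ hx, zero_mul]
    · rw [hf.partialZ_coord_lateral hρ hx, mul_zero]
  have hi := fun g h k l => integrable_rect (continuous_jac (ρ := ρ) g h k l)
  -- Antisymmetry of the Jacobian brings the last term to a form where the acceleration is
  -- undifferentiated on the boundary after Green's formula, so that its known boundary values can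
  -- be used.
  have e : ∀ x, jac₂ (f 0) (v 0) (w 0) 1 2 x = jac (w 0) (f 0) 1 2 x
      + 2 * jac (v 0) (v 0) 1 2 x - jac (w 0) (f 0) 2 1 x := by
    intro x; unfold jac₂ jac; ring
  simp only [e]
  rw [integral_sub (f := fun x => jac (w 0) (f 0) 1 2 x + 2 * jac (v 0) (v 0) 1 2 x)
      ((hi _ _ _ _).add ((hi _ _ _ _).const_mul 2)) (hi _ _ _ _),
    integral_add (hi _ _ _ _) ((hi _ _ _ _).const_mul 2), integral_const_mul, i1, i2, i3]
  ring

theorem jac_ne_zero (hρ : 0 < ρ) (x : rect ρ) : jac (f 0) (f 0) 1 2 x ≠ 0 := by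
  have h := gramDet_pos ((hf.admissible 0 hf.zero_mem).immersion x)
  intro h0
  obtain ⟨h1, h2⟩ := hf.coord_partial hρ x
  simp [gramDet, jac, h1, h2] at h
  simp [jac] at h0
  simp [h0] at h

/-- The Jacobian of `(Y, Z)` is continuous and vanishes nowhere on a connected set. Both signs must
be allowed, since `f 0` may reverse the orientation. -/
theorem exists_orientation (hρ : 0 < ρ) :
    ∃ s : ℝ, s ^ 2 = 1 ∧ ∀ x, 0 < s * jac (f 0) (f 0) 1 2 x := by
  have hc := continuous_jac (f 0) (f 0) 1 2
  have hconn : PreconnectedSpace (rect ρ) :=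
    Subtype.preconnectedSpace ((convex_Icc (-1 : ℝ) 1).prod (convex_Icc 0 ρ)).isPreconnected
  by_cases h : ∃ x, 0 < jac (f 0) (f 0) 1 2 x
  · obtain ⟨x, hx⟩ := h
    refine ⟨1, one_pow 2, fun y => ?_⟩
    rw [one_mul]
    by_contra! hy
    obtain ⟨z, hz⟩ := mem_range_of_exists_le_of_exists_ge hc ⟨y, hy⟩ ⟨x, hx.le⟩
    exact hf.jac_ne_zero hρ z hz
  · push Not at h
    refine ⟨-1, by norm_num, fun y => ?_⟩
    have := lt_of_le_of_ne (h y) (hf.jac_ne_zero hρ y)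
    linarith

end IsVariation

/-- The square of the first-order tangential change `j₁` cancels, because `sqrt (j ^ 2) = s j` is
linear in `j`; only the normal changes `p` and `q` enter quadratically. -/
theorem sqrtDeriv₂_eq {s j : ℝ} (hs : s ^ 2 = 1) (hj : 0 < s * j) (j₁ j₂ p q : ℝ) :
    sqrtDeriv₂ (j ^ 2) (2 * (j * j₁)) (2 * (j₁ ^ 2 + j * j₂ + p ^ 2 + q ^ 2)) =
      s * j₂ + (p ^ 2 + q ^ 2) / (s * j) := by
  have h1 : j ^ 2 = (s * j) ^ 2 := by rw [mul_pow, hs, one_mul]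
  have h2 : Real.sqrt (j ^ 2) = s * j := by rw [h1, Real.sqrt_sq hj.le]
  have hs0 : s ≠ 0 := fun h => by simp [h] at hj
  have hj0 : j ≠ 0 := fun h => by simp [h] at hj
  unfold sqrtDeriv₂
  rw [h2]
  field_simp
  linear_combination (-4 * (j * j₂)) * hs

/-- The second variation of the energy of the flat film: the Dirichlet energy of the normal
velocity, minus the contribution of the lateral edges. -/
theorem IsVariation.iteratedDeriv_energy {ρ a b σ s : ℝ} {f v w : ℝ → C2Space ρ}
    (hf : IsVariation ρ a b f v w) (hρ : 0 < ρ) (hs : s ^ 2 = 1)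
    (hpos : ∀ x, 0 < s * jac (f 0) (f 0) 1 2 x) :
    iteratedDeriv 2 (fun t => energy σ (f t)) 0 =
      σ * ((∫ x : rect ρ, (jac (v 0) (f 0) 0 1 x ^ 2 + jac (v 0) (f 0) 0 2 x ^ 2) /
          (s * jac (f 0) (f 0) 1 2 x) ∂(Measure.comap Subtype.val volume))
        - s * edgeFlux hρ.le fun x =>
          coord (v 0) 0 0 x ^ 2 * (coord (f 0) 0 1 x * coord (f 0) 2 2 x)) := by
  rw [SoapFilm.iteratedDeriv_energy hf.neg hf.pos hf.velocity hf.acceleration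
    hf.continuousOn_acceleration fun t ht x => (hf.admissible t ht).immersion x,
    integral_const_mul]
  congr 1
  have e : ∀ x, sqrtDeriv₂ (gramDet (f 0) x) (gramDet₁ (f 0) (v 0) x)
      (gramDet₂ (f 0) (v 0) (w 0) x) = s * jac₂ (f 0) (v 0) (w 0) 1 2 x +
      (jac (v 0) (f 0) 0 1 x ^ 2 + jac (v 0) (f 0) 0 2 x ^ 2) / (s * jac (f 0) (f 0) 1 2 x) := by
    intro x
    obtain ⟨h1, h2⟩ := hf.coord_partial hρ x
    -- The film lies in the plane `x = 0`; this is why the normal component of the acceleration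
    -- drops out.
    have hz : ∀ h l, jac (f 0) h 0 l x = 0 := fun h l => by simp [jac, h1, h2]
    rw [← sqrtDeriv₂_eq hs (hpos x) (jac (v 0) (f 0) 1 2 x + jac (f 0) (v 0) 1 2 x)]
    unfold gramDet gramDet₁ gramDet₂
    simp only [hz]
    congr 1 <;> ring
  simp only [e]
  rw [integral_add, integral_const_mul, hf.integral_jac₂ hρ]
  · ring
  · refine integrable_rect ?_
    unfold jac₂
    fun_prop
  · refine integrable_rect (Continuous.div ?_ ?_ fun x => (hpos x).ne')
    · fun_prop
    · fun_prop

/-! ### The sharp trace inequality, by Picone's method -/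

/-- The Riccati equation of the factor `cosh (κ y)`. Added to the one for `sin (κ z + δ)` in
`hasDerivAt_mul_cot`, it cancels `κ ^ 2` and gives `α' + β' = -(α ^ 2 + β ^ 2)`. -/
theorem hasDerivAt_mul_tanh (κ y : ℝ) :
    HasDerivAt (fun y => κ * Real.tanh (κ * y)) (κ ^ 2 - (κ * Real.tanh (κ * y)) ^ 2) y := by
  have hc := (Real.cosh_pos (κ * y)).ne'
  have hl : HasDerivAt (fun y => κ * y) κ y := by simpa using (hasDerivAt_id y).const_mul κ
  simp only [Real.tanh_eq_sinh_div_cosh]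
  refine ((hl.sinh.div hl.cosh hc).const_mul κ).congr_deriv ?_
  field_simp

theorem hasDerivAt_mul_cot {κ δ z : ℝ} (h : Real.sin (κ * z + δ) ≠ 0) :
    HasDerivAt (fun z => κ * (Real.cos (κ * z + δ) / Real.sin (κ * z + δ)))
      (-κ ^ 2 - (κ * (Real.cos (κ * z + δ) / Real.sin (κ * z + δ))) ^ 2) z := by
  have hl : HasDerivAt (fun z => κ * z + δ) κ z := by
    simpa using ((hasDerivAt_id z).const_mul κ).add_const δ
  refine ((hl.cos.div hl.sin h).const_mul κ).congr_deriv ?_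
  field_simp

theorem continuous_tanh : Continuous Real.tanh := by
  have : Real.tanh = fun x => Real.sinh x / Real.cosh x := funext Real.tanh_eq_sinh_div_cosh
  rw [this]
  exact Real.continuous_sinh.div Real.continuous_cosh fun x => (Real.cosh_pos x).ne'

/-- The difference of the two sides is `((q - u j α) ^ 2 + (p + u j β) ^ 2) / (s j)`. In film
coordinates `q = j u_Y` and `p = -j u_Z`, so the left side is the divergence of `u ^ 2 (α, β)` times
the area density `s j`. -/
theorem picone_le {s j : ℝ} (hs : s ^ 2 = 1) (hj : 0 < s * j) (u α β p q : ℝ) :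
    s * (2 * u * (α * q - β * p) - u ^ 2 * (α ^ 2 + β ^ 2) * j) ≤ (p ^ 2 + q ^ 2) / (s * j) := by
  rw [le_div_iff₀ hj]
  have h : s * (2 * u * (α * q - β * p) - u ^ 2 * (α ^ 2 + β ^ 2) * j) * (s * j) =
      2 * (u * j) * (α * q - β * p) - (u * j) ^ 2 * (α ^ 2 + β ^ 2) := by
    linear_combination (2 * (u * j) * (α * q - β * p) - (u * j) ^ 2 * (α ^ 2 + β ^ 2)) * hs
  rw [h]
  nlinarith [sq_nonneg (q - u * j * α), sq_nonneg (p + u * j * β)]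

theorem contDiffOn_two_hasDerivAt {E : Type*} [NormedAddCommGroup E] [NormedSpace ℝ E]
    {f : ℝ → E} {a b : ℝ} (h : ContDiffOn ℝ 2 f (Ioo a b)) :
    (∀ t ∈ Ioo a b, HasDerivAt f (deriv f t) t) ∧
      (∀ t ∈ Ioo a b, HasDerivAt (deriv f) (deriv (deriv f) t) t) ∧
      ContinuousOn (deriv (deriv f)) (Ioo a b) := by
  have h1 : ContDiffOn ℝ 1 (deriv f) (Ioo a b) :=
    h.deriv_of_isOpen isOpen_Ioo (by norm_num)
  have h2 : ContDiffOn ℝ 0 (deriv (deriv f)) (Ioo a b) :=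
    h1.deriv_of_isOpen isOpen_Ioo (by norm_num)
  exact ⟨fun t ht => ((h.differentiableOn (by norm_num)).differentiableAt
      (isOpen_Ioo.mem_nhds ht)).hasDerivAt,
    fun t ht => ((h1.differentiableOn (by norm_num)).differentiableAt
      (isOpen_Ioo.mem_nhds ht)).hasDerivAt, h2.continuousOn⟩

namespace IsVariation

variable {ρ a b : ℝ} {f v w : ℝ → C2Space ρ} (hf : IsVariation ρ a b f v w) {s : ℝ}
include hf

theorem edgeFlux_le_of_lt (hρ : 0 < ρ) (hs : s ^ 2 = 1)
    (hpos : ∀ x, 0 < s * jac (f 0) (f 0) 1 2 x) {κ : ℝ} (hκ : 0 < κ) (hκ' : κ < Real.pi / ρ) :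
    κ * Real.tanh κ * (s * edgeFlux hρ.le fun x =>
        coord (v 0) 0 0 x ^ 2 * (coord (f 0) 0 1 x * coord (f 0) 2 2 x)) ≤
      ∫ x : rect ρ, (jac (v 0) (f 0) 0 1 x ^ 2 + jac (v 0) (f 0) 0 2 x ^ 2) /
          (s * jac (f 0) (f 0) 1 2 x) ∂(Measure.comap Subtype.val volume) := by
  have hκρ : κ * ρ < Real.pi := (lt_div_iff₀ hρ).1 hκ'
  -- The shift centres the range of `κ Z + δ` in `(0, π)`, so the sine stays positive up to both
  -- wires.
  obtain ⟨δ, hδ⟩ : ∃ δ, δ = (Real.pi - κ * ρ) / 2 := ⟨_, rfl⟩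
  have hsin : ∀ x, Real.sin (κ * coord (f 0) 0 2 x + δ) ≠ 0 := by
    intro x
    obtain ⟨-, -, h1, h2⟩ := hf.coord_mem x
    have h3 := mul_nonneg hκ.le h1
    have h4 := mul_le_mul_of_nonneg_left h2 hκ.le
    exact (Real.sin_pos_of_pos_of_lt_pi (by linarith) (by linarith)).ne'
  obtain ⟨α, hα⟩ : ∃ α : ℝ → ℝ, α = fun y => κ * Real.tanh (κ * y) := ⟨_, rfl⟩
  obtain ⟨β, hβ⟩ : ∃ β : ℝ → ℝ, β = fun z => κ * (Real.cos (κ * z + δ) / Real.sin (κ * z + δ)) :=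
    ⟨_, rfl⟩
  have hαd : ∀ y, HasDerivAt α (κ ^ 2 - α y ^ 2) y := by
    intro y; subst hα; exact hasDerivAt_mul_tanh κ y
  have hβd : ∀ x, HasDerivAt β (-κ ^ 2 - β (coord (f 0) 0 2 x) ^ 2) (coord (f 0) 0 2 x) := by
    intro x; subst hβ; exact hasDerivAt_mul_cot (hsin x)
  have hαc : Continuous fun x => α (coord (f 0) 0 1 x) := by
    subst hα
    exact continuous_const.mul (continuous_tanh.comp (by fun_prop))
  have hβc : Continuous fun x => β (coord (f 0) 0 2 x) := by
    subst hβ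
    exact continuous_const.mul (Continuous.div (by fun_prop) (by fun_prop) hsin)
  have c1 := (isC1_coord (f 0) 1).comp (φ := α) (φ' := fun y => κ ^ 2 - α y ^ 2)
    (continuous_const.sub (hαc.pow 2)) fun x => hαd _
  have c2 := (isC1_coord (f 0) 2).comp (φ := β) (φ' := fun y => -κ ^ 2 - β y ^ 2)
    (continuous_const.sub (hβc.pow 2)) hβd
  have g1 := (isC1_coord (v 0) 0).sq.mul c1
  have g2 := (isC1_coord (v 0) 0).sq.mul c2
  have i1 := g1.integral_jacobian_eq_edgeFlux hρ.le (isC1_coord_partialY (f 0) 2)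
    (isC1_coord_partialZ (f 0) 2) fun x hx => by
      rw [(hf.velocity_wires hρ hf.zero_mem hx).1]; ring
  have i2 := g2.integral_jacobian_eq_edgeFlux hρ.le (isC1_coord_partialY (f 0) 1)
    (isC1_coord_partialZ (f 0) 1) fun x hx => by
      rw [(hf.velocity_wires hρ hf.zero_mem hx).1]; ring
  have e1 : (edgeFlux hρ.le fun x => coord (v 0) 0 0 x ^ 2 * α (coord (f 0) 0 1 x) *
      coord (f 0) 2 2 x) = κ * Real.tanh κ * edgeFlux hρ.le fun x =>
        coord (v 0) 0 0 x ^ 2 * (coord (f 0) 0 1 x * coord (f 0) 2 2 x) := by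
    rw [← edgeFlux_const_mul]
    refine edgeFlux_congr _ fun x hx => ?_
    -- On the lateral edges `Y` is `1` or `-1`, and `α` is odd.
    have h : α (coord (f 0) 0 1 x) = κ * Real.tanh κ * coord (f 0) 0 1 x := by
      rcases eq_or_eq_neg_of_sq_eq_sq _ 1 ((hf.coord_lateral hρ hx).trans (one_pow 2).symm) with h | h
      · simp [hα, h]
      · simp [hα, h, Real.tanh_neg]
    rw [h]; ring
  have e2 : (edgeFlux hρ.le fun x => coord (v 0) 0 0 x ^ 2 * β (coord (f 0) 0 2 x) *
      coord (f 0) 2 1 x) = 0 := by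
    refine (edgeFlux_congr (B := fun _ => 0) _ fun x hx => ?_).trans (by simp [edgeFlux])
    rw [hf.partialZ_coord_lateral hρ hx, mul_zero]
  rw [e1] at i1
  rw [e2] at i2
  have k1 := integrable_rect ((g1.contY.mul (continuous_coord (f 0) 2 2)).sub
    (g1.contZ.mul (continuous_coord (f 0) 1 2)))
  have k2 := integrable_rect ((g2.contY.mul (continuous_coord (f 0) 2 1)).sub
    (g2.contZ.mul (continuous_coord (f 0) 1 1)))
  have i3 := integral_sub k1 k2
  simp only [Pi.sub_apply, Pi.mul_apply] at i3
  rw [i1, i2, sub_zero] at i3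
  rw [mul_left_comm, ← i3, ← integral_const_mul]
  refine integral_mono ((k1.sub k2).const_mul s) (integrable_rect
    (Continuous.div (by fun_prop) (by fun_prop) fun x => (hpos x).ne')) fun x => ?_
  refine le_of_eq_of_le ?_ (picone_le hs (hpos x) (coord (v 0) 0 0 x) (α (coord (f 0) 0 1 x))
    (β (coord (f 0) 0 2 x)) (jac (v 0) (f 0) 0 1 x) (jac (v 0) (f 0) 0 2 x))
  simp only [jac]
  ring

/-- On a lateral edge `Y ^ 2` attains its maximum `1`, so `y (2 Y Y_y) ≥ 0`. Since `Y_z = 0` there,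
the orientation gives `s Y_y Z_z > 0`. Hence `s Y Z_z` has the sign of `y`, and both edges
contribute nonnegatively. -/
theorem edgeFlux_nonneg (hρ : 0 < ρ) (hpos : ∀ x, 0 < s * jac (f 0) (f 0) 1 2 x) :
    0 ≤ s * edgeFlux hρ.le fun x =>
        coord (v 0) 0 0 x ^ 2 * (coord (f 0) 0 1 x * coord (f 0) 2 2 x) := by
  have key : ∀ x : rect ρ, x.1.1 = -1 ∨ x.1.1 = 1 →
      0 ≤ x.1.1 * (s * (coord (v 0) 0 0 x ^ 2 * (coord (f 0) 0 1 x * coord (f 0) 2 2 x))) := by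
    intro x hx
    have h1 := hf.coord_lateral hρ hx
    have h2 := (isC1_coord (f 0) 1).sq.partialY_mul_nonneg hρ.le (x := x) fun x' => by
      rw [h1]; exact (hf.coord_mem x').2.1
    have h3 := hpos x
    rw [jac, hf.partialZ_coord_lateral hρ hx, zero_mul, sub_zero] at h3
    have h4 : x.1.1 ^ 2 = 1 := by rcases hx with h | h <;> rw [h] <;> norm_num
    have h5 : 0 < x.1.1 * (2 * coord (f 0) 0 1 x * coord (f 0) 1 1 x) *
        (x.1.1 * (s * (coord (f 0) 0 1 x * coord (f 0) 2 2 x))) := by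
      have : x.1.1 * (2 * coord (f 0) 0 1 x * coord (f 0) 1 1 x) *
        (x.1.1 * (s * (coord (f 0) 0 1 x * coord (f 0) 2 2 x))) = x.1.1 ^ 2 *
          coord (f 0) 0 1 x ^ 2 * (2 * (s * (coord (f 0) 1 1 x * coord (f 0) 2 2 x))) := by ring
      rw [this, h4, h1]
      linarith
    have h6 : 0 < x.1.1 * (s * (coord (f 0) 0 1 x * coord (f 0) 2 2 x)) := by
      by_contra! h
      exact absurd h5 (not_lt.2 (mul_nonpos_of_nonneg_of_nonpos h2 h))
    have h7 := mul_nonneg (sq_nonneg (coord (v 0) 0 0 x)) h6.le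
    linarith
  rw [← edgeFlux_const_mul, edgeFlux]
  have h1 : 0 ≤ ∫ z in (0 : ℝ)..ρ, s * (coord (v 0) 0 0 (clamp hρ.le (1, z)) ^ 2 *
      (coord (f 0) 0 1 (clamp hρ.le (1, z)) * coord (f 0) 2 2 (clamp hρ.le (1, z)))) := by
    refine intervalIntegral.integral_nonneg hρ.le fun z _ => ?_
    have := key _ (.inr (clamp_one hρ.le z))
    rwa [clamp_one, one_mul] at this
  have h2 : 0 ≤ ∫ z in (0 : ℝ)..ρ, -(s * (coord (v 0) 0 0 (clamp hρ.le (-1, z)) ^ 2 *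
      (coord (f 0) 0 1 (clamp hρ.le (-1, z)) * coord (f 0) 2 2 (clamp hρ.le (-1, z))))) := by
    refine intervalIntegral.integral_nonneg hρ.le fun z _ => ?_
    have := key _ (.inl (clamp_neg_one hρ.le z))
    rwa [clamp_neg_one, neg_one_mul] at this
  rw [intervalIntegral.integral_neg] at h2
  linarith

/-- The limit `κ → π / ρ` from below: at `κ = π / ρ` itself the shift `δ` is zero and the cotangent
is singular at the wires. -/
theorem edgeFlux_le (hρ : 0 < ρ) (hs : s ^ 2 = 1) (hpos : ∀ x, 0 < s * jac (f 0) (f 0) 1 2 x) :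
    Real.pi / ρ * Real.tanh (Real.pi / ρ) * (s * edgeFlux hρ.le fun x =>
        coord (v 0) 0 0 x ^ 2 * (coord (f 0) 0 1 x * coord (f 0) 2 2 x)) ≤
      ∫ x : rect ρ, (jac (v 0) (f 0) 0 1 x ^ 2 + jac (v 0) (f 0) 0 2 x ^ 2) /
          (s * jac (f 0) (f 0) 1 2 x) ∂(Measure.comap Subtype.val volume) := by
  have hk : 0 < Real.pi / ρ := div_pos Real.pi_pos hρ
  have hc : Continuous fun κ : ℝ => κ * Real.tanh κ * (s * edgeFlux hρ.le fun x =>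
        coord (v 0) 0 0 x ^ 2 * (coord (f 0) 0 1 x * coord (f 0) 2 2 x)) :=
    (continuous_id.mul continuous_tanh).mul continuous_const
  refine le_of_tendsto ((hc.tendsto (Real.pi / ρ)).mono_left 
    (nhdsWithin_le_nhds (s := Iio (Real.pi / ρ)))) ?_
  filter_upwards [Ioo_mem_nhdsLT hk] with κ hκ
  exact hf.edgeFlux_le_of_lt hρ hs hpos hκ.1 hκ.2

end IsVariation

theorem secondVariationStable_of_le {σ ρ : ℝ} (hσ : 0 < σ) (hρ : 0 < ρ)
    (h : 1 ≤ Real.pi / ρ * Real.tanh (Real.pi / ρ)) :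
    SecondVariationStable σ 0 ρ (flatFilm ρ) := by
  intro a b f ha hb hf hadm hrange
  obtain ⟨h1, h2, h3⟩ := contDiffOn_two_hasDerivAt (E := C2Space ρ) hf
  have hv : IsVariation ρ a b f (deriv f) (deriv (deriv f)) := ⟨ha, hb, h1, h2, h3, hadm, hrange⟩
  obtain ⟨s, hs, hpos⟩ := hv.exists_orientation hρ
  rw [hv.iteratedDeriv_energy hρ hs hpos]
  refine mul_nonneg hσ.le (sub_nonneg.2 (le_trans ?_ (hv.edgeFlux_le hρ hs hpos)))
  exact le_mul_of_one_le_left (hv.edgeFlux_nonneg hρ hpos) h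

/-! ### Smooth families as differentiable curves in `C2Space` -/

theorem hasDerivAt_submodule_of_coe {E : Type*} [NormedAddCommGroup E] [NormedSpace ℝ E]
    {S : Submodule ℝ E} {f : ℝ → S} {v : S} {t : ℝ}
    (h : HasDerivAt (fun t => (f t : E)) v t) : HasDerivAt f v t := by
  rw [hasDerivAt_iff_isLittleO] at h ⊢
  rw [← Asymptotics.isLittleO_norm_left] at h ⊢
  exact h

theorem contDiff_two_of_hasDerivAt {E : Type*} [NormedAddCommGroup E] [NormedSpace ℝ E]
    {f v w : ℝ → E} (hf : ∀ t, HasDerivAt f (v t) t) (hv : ∀ t, HasDerivAt v (w t) t)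
    (hw : Continuous w) : ContDiff ℝ 2 f := by
  have e1 : deriv f = v := funext fun t => (hf t).deriv
  have e2 : deriv v = w := funext fun t => (hv t).deriv
  have h1 : ContDiff ℝ 1 v :=
    contDiff_one_iff_deriv.2 ⟨fun t => (hv t).differentiableAt, by rwa [e2]⟩
  rw [show (2 : WithTop ℕ∞) = 1 + 1 from rfl, contDiff_succ_iff_deriv]
  exact ⟨fun t => (hf t).differentiableAt, by simp, by rwa [e1]⟩

/-- The derivative of `G` in the direction `e`, as a function. -/
noncomputable def dirDeriv (e : ℝ × ℝ × ℝ) (G : ℝ × ℝ × ℝ → R3) : ℝ × ℝ × ℝ → R3 :=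
  fun p => fderiv ℝ G p e

section Slice

variable {G : ℝ × ℝ × ℝ → R3}

theorem contDiff_dirDeriv (e : ℝ × ℝ × ℝ) (hG : ContDiff ℝ ⊤ G) : ContDiff ℝ ⊤ (dirDeriv e G) :=
  (hG.fderiv_right (m := ⊤) le_top).clm_apply contDiff_const

theorem dirDeriv_comm (hG : ContDiff ℝ ⊤ G) (e e' : ℝ × ℝ × ℝ) :
    dirDeriv e (dirDeriv e' G) = dirDeriv e' (dirDeriv e G) := by
  have key : ∀ e e' p, dirDeriv e (dirDeriv e' G) p = fderiv ℝ (fderiv ℝ G) p e e' := by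
    intro e e' p
    have h : DifferentiableAt ℝ (fderiv ℝ G) p :=
      ((hG.fderiv_right (m := ⊤) le_top).differentiable (by simp)) p
    unfold dirDeriv
    rw [fderiv_clm_apply h (differentiableAt_const e')]
    simp
  ext1 p
  rw [key, key]
  exact (hG.contDiffAt.isSymmSndFDerivAt (by simp)) e e'

theorem hasFDerivAt_slice (hG : ContDiff ℝ ⊤ G) (t : ℝ) (p : ℝ × ℝ) :
    HasFDerivAt (fun p => G (t, p))
      (linMap (dirDeriv (0, 1, 0) G (t, p)) (dirDeriv (0, 0, 1) G (t, p))) p := by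
  have h := ((hG.differentiable (by simp)) (t, p)).hasFDerivAt.comp p (hasFDerivAt_prodMk_right t p)
  refine h.congr_fderiv ?_
  ext <;> simp [linMap, dirDeriv]

/-- The restriction of `G (t, ·)` to the rectangle. -/
def sliceMap (ρ : ℝ) (hG : Continuous G) (t : ℝ) : C(rect ρ, R3) :=
  ⟨fun x => G (t, x.1), by fun_prop⟩

theorem continuous_sliceMap (ρ : ℝ) (hG : Continuous G) : Continuous (sliceMap ρ hG) := by
  refine ContinuousMap.continuous_of_continuous_uncurry _ ?_
  change Continuous fun p : ℝ × rect ρ => G (p.1, p.2.1)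
  fun_prop

/-- To pass from pointwise derivatives to a derivative in the supremum norm, the curve is written as
the integral of a continuous curve in `C(rect ρ, R3)`, to which the fundamental theorem of calculus
applies. -/
theorem hasDerivAt_sliceMap (ρ : ℝ) (hG : ContDiff ℝ ⊤ G) (t : ℝ) :
    HasDerivAt (sliceMap ρ hG.continuous)
      (sliceMap ρ (contDiff_dirDeriv (1, 0, 0) hG).continuous t) t := by
  have hc := continuous_sliceMap ρ (contDiff_dirDeriv (1, 0, 0) hG).continuous
  have hd : ∀ (p : ℝ × ℝ) (t : ℝ), HasDerivAt (fun t => G (t, p)) (dirDeriv (1, 0, 0) G (t, p)) t :=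
    fun p t => ((hG.differentiable (by simp)) (t, p)).hasFDerivAt.comp_hasDerivAt t
      ((hasDerivAt_id t).prodMk (hasDerivAt_const t p))
  have e : sliceMap ρ hG.continuous = fun t => sliceMap ρ hG.continuous 0 +
      ∫ s in (0 : ℝ)..t, sliceMap ρ (contDiff_dirDeriv (1, 0, 0) hG).continuous s := by
    ext1 t
    ext1 x
    have h1 := (ContinuousMap.evalCLM ℝ x).intervalIntegral_comp_comm
      (hc.intervalIntegrable (μ := volume) 0 t)
    rw [ContinuousMap.add_apply]
    change _ = _ + ContinuousMap.evalCLM ℝ x (∫ s in (0 : ℝ)..t, _)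
    rw [← h1]
    change G (t, x.1) = G (0, x.1) + ∫ s in (0 : ℝ)..t, dirDeriv (1, 0, 0) G (s, x.1)
    rw [intervalIntegral.integral_eq_sub_of_hasDerivAt (fun s _ => hd x.1 s)]
    · abel
    · refine Continuous.intervalIntegrable ?_ _ _
      exact (contDiff_dirDeriv (1, 0, 0) hG).continuous.comp (by fun_prop)
  rw [e]
  exact ((hc.integral_hasStrictDerivAt 0 t).hasDerivAt).const_add _

/-- `G` and its partial derivatives of order at most two in the last two variables. -/
noncomputable def jets (G : ℝ × ℝ × ℝ → R3) (i : Fin 6) : ℝ × ℝ × ℝ → R3 :=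
  ![G, dirDeriv (0, 1, 0) G, dirDeriv (0, 0, 1) G, dirDeriv (0, 1, 0) (dirDeriv (0, 1, 0) G),
    dirDeriv (0, 1, 0) (dirDeriv (0, 0, 1) G), dirDeriv (0, 0, 1) (dirDeriv (0, 0, 1) G)] i

theorem contDiff_jets (hG : ContDiff ℝ ⊤ G) (i : Fin 6) : ContDiff ℝ ⊤ (jets G i) := by
  fin_cases i
  · exact hG
  · exact contDiff_dirDeriv _ hG
  · exact contDiff_dirDeriv _ hG
  · exact contDiff_dirDeriv _ (contDiff_dirDeriv _ hG)
  · exact contDiff_dirDeriv _ (contDiff_dirDeriv _ hG)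
  · exact contDiff_dirDeriv _ (contDiff_dirDeriv _ hG)

/-- Partial derivatives commute; hence the time derivative of the jet of a family is again the jet
of a map, and the velocity lies in `C2Space`. -/
theorem dirDeriv_jets (hG : ContDiff ℝ ⊤ G) (e : ℝ × ℝ × ℝ) (i : Fin 6) :
    dirDeriv e (jets G i) = jets (dirDeriv e G) i := by
  have h1 := fun e' => dirDeriv_comm hG e e'
  have h2 := fun e₁ e₂ => dirDeriv_comm (contDiff_dirDeriv e₁ hG) e e₂
  fin_cases i
  · rfl
  · exact h1 _
  · exact h1 _
  · exact (h2 _ _).trans (by rw [h1]; rfl)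
  · exact (h2 _ _).trans (by rw [h1]; rfl)
  · exact (h2 _ _).trans (by rw [h1]; rfl)

/-- The element of `C2Space` given by `G (t, ·)`. -/
noncomputable def slice (ρ : ℝ) (hG : ContDiff ℝ ⊤ G) (t : ℝ) : C2Space ρ :=
  ⟨fun i => sliceMap ρ (contDiff_jets hG i).continuous t, fun i p => jets G i (t, p),
    fun _ _ => rfl, fun x => ⟨(hasFDerivAt_slice hG t x.1).hasFDerivWithinAt, by
      have h := hasFDerivAt_slice (contDiff_dirDeriv (0, 1, 0) hG) t x.1
      rw [dirDeriv_comm hG (0, 0, 1) (0, 1, 0)] at h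
      exact h.hasFDerivWithinAt,
      (hasFDerivAt_slice (contDiff_dirDeriv (0, 0, 1) hG) t x.1).hasFDerivWithinAt⟩⟩

theorem hasDerivAt_slice (ρ : ℝ) (hG : ContDiff ℝ ⊤ G) (t : ℝ) :
    HasDerivAt (slice ρ hG) (slice ρ (contDiff_dirDeriv (1, 0, 0) hG) t) t := by
  refine hasDerivAt_submodule_of_coe (S := C2Space ρ) (hasDerivAt_pi.2 fun i => ?_)
  have h := hasDerivAt_sliceMap ρ (contDiff_jets hG i) t
  have e : sliceMap ρ (contDiff_dirDeriv (1, 0, 0) (contDiff_jets hG i)).continuous t =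
      sliceMap ρ (contDiff_jets (contDiff_dirDeriv (1, 0, 0) hG) i).continuous t := by
    ext1 x
    change dirDeriv (1, 0, 0) (jets G i) _ = jets (dirDeriv (1, 0, 0) G) i _
    rw [dirDeriv_jets hG]
  rw [e] at h
  exact h

/-- Reduces each partial derivative of the explicit family to a one-variable computation along a
line. -/
theorem dirDeriv_apply_eq {e : ℝ × ℝ × ℝ} {p : ℝ × ℝ × ℝ} {k : Fin 3} {d : ℝ}
    (hG : ContDiff ℝ ⊤ G) (h : HasDerivAt (fun s : ℝ => G (p + s • e) k) d 0) :
    dirDeriv e G p k = d := by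
  have h1 : HasDerivAt (fun s : ℝ => p + s • e) e 0 := by
    simpa using ((hasDerivAt_id (0 : ℝ)).smul_const e).const_add p
  have h2 : HasFDerivAt G (fderiv ℝ G p) (p + (0 : ℝ) • e) := by
    simpa using ((hG.differentiable (by simp)) p).hasFDerivAt
  have h3 := (EuclideanSpace.proj (𝕜 := ℝ) k).hasFDerivAt.comp_hasDerivAt (0 : ℝ)
    (h2.comp_hasDerivAt (0 : ℝ) h1)
  exact h3.unique h

end Slice

/-! ### The test family and necessity -/

/-- A family of films, the edges of which rotate along the cylinder; the normal velocity at the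
flat film is `sin (k z) cosh (k y) / cosh k`. -/
noncomputable def tilted (k : ℝ) (p : ℝ × ℝ × ℝ) : R3 :=
  !₂[Real.sin (p.1 * Real.sin (k * p.2.2)) * (Real.cosh (k * p.2.1) / Real.cosh k),
    p.2.1 * Real.cos (p.1 * Real.sin (k * p.2.2)), p.2.2]

theorem contDiff_tilted (k : ℝ) : ContDiff ℝ ⊤ (tilted k) := by
  rw [contDiff_euclidean]
  have h1 : ContDiff ℝ ⊤ fun p : ℝ × ℝ × ℝ => p.1 * Real.sin (k * p.2.2) :=
    contDiff_fst.mul (contDiff_const.mul contDiff_snd.snd).sin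
  intro i
  fin_cases i
  · exact h1.sin.mul ((contDiff_const.mul contDiff_snd.fst).cosh.div_const _)
  · exact contDiff_snd.fst.mul h1.cos
  · exact contDiff_snd.snd

theorem hasDerivAt_line {φ : ℝ → ℝ} {c d : ℝ} (h : HasDerivAt φ d c) :
    HasDerivAt (fun s => φ (c + s)) d 0 := by
  have h1 : HasDerivAt φ d (c + 0) := by simpa using h
  exact h1.comp_const_add c 0

theorem tilted_velocity (k y z : ℝ) :
    dirDeriv (1, 0, 0) (tilted k) (0, y, z) 0 =
      Real.sin (k * z) * (Real.cosh (k * y) / Real.cosh k) := by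
  refine dirDeriv_apply_eq (contDiff_tilted k) ?_
  have h : HasDerivAt (fun s : ℝ => s * Real.sin (k * z)) (Real.sin (k * z)) 0 := by
    simpa using (hasDerivAt_id (0 : ℝ)).mul_const (Real.sin (k * z))
  have h1 := h.sin.mul_const (Real.cosh (k * y) / Real.cosh k)
  simpa [tilted] using h1

theorem hasDerivAt_const_mul_id (k c : ℝ) : HasDerivAt (fun s => k * s) k c := by
  simpa using (hasDerivAt_id c).const_mul k

theorem tilted_velocity_y (k y z : ℝ) :
    dirDeriv (0, 1, 0) (dirDeriv (1, 0, 0) (tilted k)) (0, y, z) 0 =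
      Real.sin (k * z) * (Real.sinh (k * y) * k / Real.cosh k) := by
  refine dirDeriv_apply_eq (contDiff_dirDeriv _ (contDiff_tilted k)) ?_
  have h := hasDerivAt_line (((hasDerivAt_const_mul_id k y).cosh.div_const
    (Real.cosh k)).const_mul (Real.sin (k * z)))
  simpa [tilted_velocity] using h

theorem tilted_velocity_z (k y z : ℝ) :
    dirDeriv (0, 0, 1) (dirDeriv (1, 0, 0) (tilted k)) (0, y, z) 0 =
      Real.cos (k * z) * k * (Real.cosh (k * y) / Real.cosh k) := by
  refine dirDeriv_apply_eq (contDiff_dirDeriv _ (contDiff_tilted k)) ?_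
  have h := hasDerivAt_line (((hasDerivAt_const_mul_id k z).sin).mul_const
    (Real.cosh (k * y) / Real.cosh k))
  simpa [tilted_velocity] using h

theorem tilted_velocity_yy (k y z : ℝ) :
    dirDeriv (0, 1, 0) (dirDeriv (0, 1, 0) (dirDeriv (1, 0, 0) (tilted k))) (0, y, z) 0 =
      Real.sin (k * z) * (Real.cosh (k * y) * k * k / Real.cosh k) := by
  refine dirDeriv_apply_eq (contDiff_dirDeriv _ (contDiff_dirDeriv _ (contDiff_tilted k))) ?_
  have h := hasDerivAt_line ((((hasDerivAt_const_mul_id k y).sinh.mul_const k).div_const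
    (Real.cosh k)).const_mul (Real.sin (k * z)))
  simpa [tilted_velocity_y] using h

theorem tilted_velocity_zz (k y z : ℝ) :
    dirDeriv (0, 0, 1) (dirDeriv (0, 0, 1) (dirDeriv (1, 0, 0) (tilted k))) (0, y, z) 0 =
      -Real.sin (k * z) * k * k * (Real.cosh (k * y) / Real.cosh k) := by
  refine dirDeriv_apply_eq (contDiff_dirDeriv _ (contDiff_dirDeriv _ (contDiff_tilted k))) ?_
  have h := hasDerivAt_line ((((hasDerivAt_const_mul_id k z).cos).mul_const k).mul_const
    (Real.cosh (k * y) / Real.cosh k))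
  simpa [tilted_velocity_z] using h

theorem tilted_partialY (k t y z : ℝ) :
    dirDeriv (0, 1, 0) (tilted k) (t, y, z) 1 = Real.cos (t * Real.sin (k * z)) ∧
      dirDeriv (0, 1, 0) (tilted k) (t, y, z) 2 = 0 := by
  refine ⟨dirDeriv_apply_eq (contDiff_tilted k) ?_, dirDeriv_apply_eq (contDiff_tilted k) ?_⟩
  · have h := hasDerivAt_line ((hasDerivAt_id y).mul_const (Real.cos (t * Real.sin (k * z))))
    simpa [tilted] using h
  · simpa [tilted] using hasDerivAt_const (0 : ℝ) z

theorem tilted_partialZ (k t y z : ℝ) : dirDeriv (0, 0, 1) (tilted k) (t, y, z) 2 = 1 := by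
  refine dirDeriv_apply_eq (contDiff_tilted k) ?_
  simpa [tilted] using hasDerivAt_line (hasDerivAt_id z)

theorem tilted_zero_partialZ (k y z : ℝ) : dirDeriv (0, 0, 1) (tilted k) (0, y, z) 1 = 0 := by
  refine dirDeriv_apply_eq (contDiff_tilted k) ?_
  simpa [tilted] using hasDerivAt_const (0 : ℝ) y

/-- The choice `k = π / ρ` makes `sin (k z)` vanish on both wires. At `y = ±1` the quotient of
hyperbolic cosines is `1`, so these edges stay on the wall. For `|t| < 1` the angle is at most `1 <
π / 2`; its cosine is then positive, and the second and third components alone give injectivity and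
immersion. -/
theorem isAdmissible_tilted {ρ t : ℝ} (hρ : 0 < ρ) (ht : t ∈ Ioo (-1 : ℝ) 1) :
    IsAdmissible 0 ρ (slice ρ (contDiff_tilted (Real.pi / ρ)) t) := by
  obtain ⟨k, hk⟩ : ∃ k, k = Real.pi / ρ := ⟨_, rfl⟩
  rw [← hk]
  have hcos : ∀ z, 0 < Real.cos (t * Real.sin (k * z)) := by
    intro z
    have h1 : |t * Real.sin (k * z)| ≤ 1 := by
      rw [abs_mul]
      exact mul_le_one₀ (abs_le.2 ⟨ht.1.le, ht.2.le⟩) (abs_nonneg _) (Real.abs_sin_le_one _)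
    have h2 := abs_le.1 h1
    have h3 := Real.pi_gt_three
    exact Real.cos_pos_of_mem_Ioo ⟨by linarith, by linarith⟩
  have hmap : ∀ x : rect ρ, toMap (slice ρ (contDiff_tilted k) t) x = tilted k (t, x.1) :=
    fun _ => rfl
  have hsin : ∀ x ∈ wireEdges ρ, Real.sin (k * x.1.2) = 0 := by
    rintro x (h | h)
    · simp [h]
    · rw [h, hk, div_mul_cancel₀ _ hρ.ne', Real.sin_pi]
  have hwire : ∀ x ∈ wireEdges ρ, tilted k (t, x.1) = !₂[0, x.1.1, x.1.2] := by
    intro x hx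
    simp [tilted, hsin x hx]
  refine ⟨fun x x' h => ?_, fun x => ?_, ?_, ?_⟩
  · rw [hmap, hmap] at h
    have h2 : x.1.2 = x'.1.2 := by simpa [tilted] using congrArg (fun p : R3 => p 2) h
    have h1 : x.1.1 = x'.1.1 := by
      have := congrArg (fun p : R3 => p 1) h
      simp only [tilted, h2] at this
      exact mul_right_cancel₀ (hcos x'.1.2).ne' (by simpa using this)
    exact Subtype.ext (Prod.ext h1 h2)
  · rw [LinearIndependent.pair_iff]
    intro c d h
    change c • dirDeriv (0, 1, 0) (tilted k) (t, x.1) +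
      d • dirDeriv (0, 0, 1) (tilted k) (t, x.1) = 0 at h
    have e1 : dirDeriv (0, 1, 0) (tilted k) (t, x.1) 1 = _ := (tilted_partialY k t x.1.1 x.1.2).1
    have e2 : dirDeriv (0, 1, 0) (tilted k) (t, x.1) 2 = 0 := (tilted_partialY k t x.1.1 x.1.2).2
    have e3 : dirDeriv (0, 0, 1) (tilted k) (t, x.1) 2 = 1 := tilted_partialZ k t x.1.1 x.1.2
    have hd : d = 0 := by
      have := congrArg (fun p : R3 => p 2) h
      simpa [e2, e3] using this
    have hc := congrArg (fun p : R3 => p 1) h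
    simpa [e1, hd, (hcos x.1.2).ne'] using hc
  · apply Subset.antisymm
    · rintro - ⟨x, hx, rfl⟩
      rw [hmap, hwire x hx]
      rcases hx with h | h
      · exact .inl ⟨x.1.1, x.2.1.1, x.2.1.2, by rw [h]⟩
      · exact .inr ⟨x.1.1, x.2.1.1, x.2.1.2, by simp [h]⟩
    · rintro - (⟨s, h1, h2, rfl⟩ | ⟨s, h1, h2, rfl⟩)
      · have hx : (⟨(s, 0), ⟨h1, h2⟩, by simp [hρ.le]⟩ : rect ρ) ∈ wireEdges ρ := .inl rfl
        exact ⟨_, hx, by rw [hmap, hwire _ hx]⟩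
      · have hx : (⟨(s, ρ), ⟨h1, h2⟩, by simp [hρ.le]⟩ : rect ρ) ∈ wireEdges ρ := .inr rfl
        exact ⟨_, hx, by rw [hmap, hwire _ hx]; simp⟩
  · rintro - ⟨x, ⟨h, h1, h2⟩, rfl⟩
    rw [hmap]
    have hc := (Real.cosh_pos k).ne'
    refine ⟨?_, h1.le, h2.le⟩
    rcases h with h | h <;> simp [tilted, h, hc]

theorem isVariation_tilted {ρ : ℝ} (hρ : 0 < ρ) :
    IsVariation ρ (-1) 1 (slice ρ (contDiff_tilted (Real.pi / ρ)))
      (slice ρ (contDiff_dirDeriv (1, 0, 0) (contDiff_tilted (Real.pi / ρ))))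
      (slice ρ (contDiff_dirDeriv (1, 0, 0)
        (contDiff_dirDeriv (1, 0, 0) (contDiff_tilted (Real.pi / ρ))))) where
  neg := by norm_num
  pos := by norm_num
  velocity t _ := hasDerivAt_slice ρ _ t
  acceleration t _ := hasDerivAt_slice ρ _ t
  continuousOn_acceleration :=
    continuousOn_of_hasDerivAt (E := C2Space ρ) fun t _ => hasDerivAt_slice ρ _ t
  admissible t ht := isAdmissible_tilted hρ ht
  range_eq := by
    ext p
    constructor
    · rintro ⟨x, rfl⟩
      change tilted _ (0, x.1) ∈ flatFilm ρ
      exact ⟨by simp [tilted], by simpa [tilted] using x.2.1, by simpa [tilted] using x.2.2⟩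
    · rintro ⟨h0, h1, h2⟩
      refine ⟨⟨(p 1, p 2), h1, h2⟩, ?_⟩
      change tilted _ (0, p 1, p 2) = p
      ext i
      fin_cases i <;> simp [tilted, h0]

/-- The second variation of the energy along the family `tilted`. -/
theorem iteratedDeriv_energy_tilted {ρ : ℝ} (σ : ℝ) (hρ : 0 < ρ) :
    iteratedDeriv 2 (fun t => energy σ (slice ρ (contDiff_tilted (Real.pi / ρ)) t)) 0 =
      σ * ((Real.pi / ρ * Real.tanh (Real.pi / ρ) - 1) *
        (2 * ∫ z in (0 : ℝ)..ρ, Real.sin (Real.pi / ρ * z) ^ 2)) := by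
  have hf := isVariation_tilted hρ
  obtain ⟨k, hk⟩ : ∃ k, k = Real.pi / ρ := ⟨_, rfl⟩
  rw [← hk] at hf ⊢
  have hc := (Real.cosh_pos k).ne'
  obtain ⟨f, hfd⟩ : ∃ f, f = slice ρ (contDiff_tilted k) := ⟨_, rfl⟩
  obtain ⟨v, hvd⟩ : ∃ v, v = slice ρ (contDiff_dirDeriv (1, 0, 0) (contDiff_tilted k)) := ⟨_, rfl⟩
  have f11 : ∀ x, coord (f 0) 1 1 x = 1 := fun x => by
    rw [hfd]; exact (tilted_partialY k 0 x.1.1 x.1.2).1.trans (by simp)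
  have f12 : ∀ x, coord (f 0) 1 2 x = 0 := fun x => by
    rw [hfd]; exact (tilted_partialY k 0 x.1.1 x.1.2).2
  have f21 : ∀ x, coord (f 0) 2 1 x = 0 := fun x => by
    rw [hfd]; exact tilted_zero_partialZ k x.1.1 x.1.2
  have f22 : ∀ x, coord (f 0) 2 2 x = 1 := fun x => by
    rw [hfd]; exact tilted_partialZ k 0 x.1.1 x.1.2
  have f01 : ∀ x, coord (f 0) 0 1 x = x.1.1 := fun x => by
    rw [hfd]; change tilted k (0, x.1) 1 = _; simp [tilted]
  have v0 : ∀ x, coord (v 0) 0 0 x =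
      Real.sin (k * x.1.2) * (Real.cosh (k * x.1.1) / Real.cosh k) := fun x => by
    rw [hvd]; exact tilted_velocity k x.1.1 x.1.2
  have v1 : ∀ x, coord (v 0) 1 0 x =
      Real.sin (k * x.1.2) * (Real.sinh (k * x.1.1) * k / Real.cosh k) := fun x => by
    rw [hvd]; exact tilted_velocity_y k x.1.1 x.1.2
  -- The normal velocity is harmonic.
  have v35 : ∀ x, coord (v 0) 3 0 x + coord (v 0) 5 0 x = 0 := fun x => by
    rw [hvd]
    refine (congrArg₂ (· + ·) (tilted_velocity_yy k x.1.1 x.1.2)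
      (tilted_velocity_zz k x.1.1 x.1.2)).trans ?_
    ring
  rw [← hfd, ← hvd] at hf
  rw [← hfd, hf.iteratedDeriv_energy hρ (one_pow 2) fun x => by simp [jac, f11, f12, f21, f22]]
  congr 1
  have i1 := ((isC1_coord (v 0) 0).mul (isC1_coord_partialY (v 0) 0)).integral_jacobian_eq_edgeFlux
    hρ.le (isC1_coord_partialY (f 0) 2) (isC1_coord_partialZ (f 0) 2) fun x _ => by simp [f12]
  have i2 := ((isC1_coord (v 0) 0).mul (isC1_coord_partialZ (v 0) 0)).integral_jacobian_eq_edgeFlux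
    hρ.le (isC1_coord_partialY (f 0) 1) (isC1_coord_partialZ (f 0) 1) fun x hx => by
      rw [(hf.velocity_wires hρ hf.zero_mem hx).1]; ring
  simp only [f11, f12, f21, f22, mul_zero, mul_one, sub_zero, zero_sub, integral_neg] at i1 i2
  have e0 : (edgeFlux hρ.le fun _ => 0) = 0 := by simp [edgeFlux]
  rw [e0, neg_eq_zero] at i2
  have k1 := integrable_rect ((isC1_coord (v 0) 0).mul (isC1_coord_partialY (v 0) 0)).contY
  have k2 := integrable_rect ((isC1_coord (v 0) 0).mul (isC1_coord_partialZ (v 0) 0)).contZ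
  have i3 := integral_add k1 k2
  rw [i1, i2, add_zero] at i3
  -- Adding `u (u_yy + u_zz) = 0` turns the Dirichlet integrand into the divergence of `u ∇u`, so
  -- only the flux through the lateral edges remains.
  have e1 : ∀ x, (jac (v 0) (f 0) 0 1 x ^ 2 + jac (v 0) (f 0) 0 2 x ^ 2) /
      (1 * jac (f 0) (f 0) 1 2 x) = coord (v 0) 1 0 x * coord (v 0) 1 0 x +
        coord (v 0) 0 0 x * coord (v 0) 3 0 x + (coord (v 0) 2 0 x * coord (v 0) 2 0 x +
        coord (v 0) 0 0 x * coord (v 0) 5 0 x) := by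
    intro x
    simp only [jac, f11, f12, f21, f22]
    linear_combination -coord (v 0) 0 0 x * v35 x
  simp only [e1]
  rw [i3, one_mul]
  have e2 : (edgeFlux hρ.le fun x => coord (v 0) 0 0 x * coord (v 0) 1 0 x) =
      edgeFlux hρ.le fun x => k * Real.tanh k * (Real.sin (k * x.1.2) ^ 2 * x.1.1) := by
    refine edgeFlux_congr _ fun x hx => ?_
    rw [v0, v1, Real.tanh_eq_sinh_div_cosh]
    rcases hx with h | h <;> rw [h] <;> simp <;> field_simp
  have e3 : (edgeFlux hρ.le fun x => coord (v 0) 0 0 x ^ 2 *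
      (coord (f 0) 0 1 x * coord (f 0) 2 2 x)) =
      edgeFlux hρ.le fun x => Real.sin (k * x.1.2) ^ 2 * x.1.1 := by
    refine edgeFlux_congr _ fun x hx => ?_
    rw [v0, f01, f22]
    rcases hx with h | h <;> rw [h] <;> simp <;> field_simp
  have e4 : (edgeFlux hρ.le fun x => Real.sin (k * x.1.2) ^ 2 * x.1.1) =
      2 * ∫ z in (0 : ℝ)..ρ, Real.sin (k * z) ^ 2 := by
    have hz : ∀ y, ∫ z in (0 : ℝ)..ρ, Real.sin (k * (clamp hρ.le (y, z)).1.2) ^ 2 =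
        ∫ z in (0 : ℝ)..ρ, Real.sin (k * z) ^ 2 := by
      intro y
      refine intervalIntegral.integral_congr fun z hz => ?_
      rw [uIcc_of_le hρ.le] at hz
      simp only [clamp_snd_of_mem hρ.le hz]
    simp only [edgeFlux, clamp_one, clamp_neg_one, mul_one, mul_neg, intervalIntegral.integral_neg,
      hz]
    ring
  rw [e2, e3, edgeFlux_const_mul, e4]
  ring

theorem le_of_secondVariationStable {σ ρ : ℝ} (hσ : 0 < σ) (hρ : 0 < ρ)
    (h : SecondVariationStable σ 0 ρ (flatFilm ρ)) :
    1 ≤ Real.pi / ρ * Real.tanh (Real.pi / ρ) := by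
  have hf := isVariation_tilted hρ
  have hC := contDiff_two_of_hasDerivAt (E := C2Space ρ)
    (fun t => hasDerivAt_slice ρ (contDiff_tilted (Real.pi / ρ)) t)
    (fun t => hasDerivAt_slice ρ _ t) (continuousOn_univ.1 (continuousOn_of_hasDerivAt
      (E := C2Space ρ) fun t _ => hasDerivAt_slice ρ _ t))
  have h1 := h (-1) 1 _ hf.neg hf.pos hC.contDiffOn hf.admissible hf.range_eq
  rw [iteratedDeriv_energy_tilted σ hρ] at h1
  have h2 : 0 < ∫ z in (0 : ℝ)..ρ, Real.sin (Real.pi / ρ * z) ^ 2 := by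
    refine intervalIntegral.intervalIntegral_pos_of_pos_on
      (Continuous.intervalIntegrable (by fun_prop) _ _) (fun z hz => ?_) hρ
    have h3 : 0 < Real.pi / ρ := div_pos Real.pi_pos hρ
    have h4 : Real.pi / ρ * z < Real.pi := by
      calc Real.pi / ρ * z < Real.pi / ρ * ρ := mul_lt_mul_of_pos_left hz.2 h3
        _ = Real.pi := div_mul_cancel₀ _ hρ.ne'
    exact pow_pos (Real.sin_pos_of_pos_of_lt_pi (mul_pos h3 hz.1) h4) 2
  have h5 := nonneg_of_mul_nonneg_right h1 hσ
  have h6 := nonneg_of_mul_nonneg_left h5 (by linarith)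
  linarith

/-! ### The critical length -/

theorem tanh_eq_exp (x : ℝ) :
    Real.tanh x = (Real.exp (2 * x) - 1) / (Real.exp (2 * x) + 1) := by
  have h : Real.exp (2 * x) = Real.exp x * Real.exp x := by rw [← Real.exp_add]; ring_nf
  have h2 : Real.exp x * Real.exp (-x) = 1 := by rw [← Real.exp_add]; simp
  rw [Real.tanh_eq_sinh_div_cosh, Real.sinh_eq, Real.cosh_eq, h,
    div_div_div_cancel_right₀ two_ne_zero, div_eq_div_iff (by positivity) (by positivity)]
  linear_combination (-2 * Real.exp x) * h2

theorem mul_tanh_strictMonoOn : StrictMonoOn (fun x => x * Real.tanh x) (Ioi 0) := by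
  intro x hx y hy hxy
  have hx : 0 < x := hx
  have hy : 0 < y := hy
  have h1 : Real.tanh x < Real.tanh y := by
    have hE := Real.exp_lt_exp.2 (show 2 * x < 2 * y by linarith)
    rw [tanh_eq_exp, tanh_eq_exp, div_lt_div_iff₀ (by positivity) (by positivity)]
    nlinarith
  have h2 : 0 < Real.tanh x := by
    rw [tanh_eq_exp]
    have := Real.one_lt_exp_iff.2 (show 0 < 2 * x by linarith)
    exact div_pos (by linarith) (by positivity)
  exact mul_lt_mul'' hxy h1 hx.le h2.le

/-- Since `2.4 = 12 / 5`, comparing fifth powers reduces the bounds to decimal bounds for `e`. -/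
theorem exp_two_point_four_bounds : 11.02 < Real.exp 2.4 ∧ Real.exp 2.4 < 11.03 := by
  have h : Real.exp 2.4 ^ 5 = Real.exp 1 ^ 12 := by
    rw [← Real.exp_nat_mul, ← Real.exp_nat_mul]; norm_num
  constructor
  · refine lt_of_pow_lt_pow_left₀ 5 (Real.exp_pos _).le ?_
    rw [h]
    exact lt_trans (by norm_num) (pow_lt_pow_left₀ Real.exp_one_gt_d9 (by norm_num) (by norm_num))
  · refine lt_of_pow_lt_pow_left₀ 5 (by norm_num) ?_
    rw [h]
    exact lt_trans (pow_lt_pow_left₀ Real.exp_one_lt_d9 (Real.exp_pos _).le (by norm_num))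
      (by norm_num)

/-- The endpoints lie just inside `π / 2.625` and `π / 2.615`, as the tolerance on `ρc = π / κ`
requires. For `x > 1`, `x tanh x < 1` means `exp (2 x) < (x + 1) / (x - 1)`; as `2 * 1.197 < 2.4 < 2
* 1.2013`, the bounds for `exp 2.4` settle both ends. -/
theorem exists_mul_tanh_eq_one : ∃ κ : ℝ, κ ∈ Ioo 1.197 1.2013 ∧ κ * Real.tanh κ = 1 := by
  obtain ⟨h1, h2⟩ := exp_two_point_four_bounds
  have hl : 1.197 * Real.tanh 1.197 < 1 := by
    have h3 : Real.exp (2 * 1.197) ≤ Real.exp 2.4 := Real.exp_le_exp.2 (by norm_num)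
    rw [tanh_eq_exp, mul_div_assoc', div_lt_one (by positivity)]
    linarith
  have hr : 1 < 1.2013 * Real.tanh 1.2013 := by
    have h3 : Real.exp 2.4 ≤ Real.exp (2 * 1.2013) := Real.exp_le_exp.2 (by norm_num)
    rw [tanh_eq_exp, mul_div_assoc', one_lt_div (by positivity)]
    linarith
  have hc : Continuous fun x : ℝ => x * Real.tanh x := continuous_id.mul continuous_tanh
  obtain ⟨κ, hκ, h⟩ := intermediate_value_Ioo (by norm_num : (1.197 : ℝ) ≤ 1.2013)
    hc.continuousOn ⟨hl, hr⟩
  exact ⟨κ, hκ, h⟩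

theorem exists_critical_length : ∃ ρc : ℝ, |ρc - 2.62| < 0.005 ∧
    ∀ ρ : ℝ, 0 < ρ → (1 ≤ Real.pi / ρ * Real.tanh (Real.pi / ρ) ↔ ρ ≤ ρc) := by
  obtain ⟨κ, ⟨h1, h2⟩, h⟩ := exists_mul_tanh_eq_one
  have hκ : 0 < κ := by linarith
  refine ⟨Real.pi / κ, ?_, fun ρ hρ => ?_⟩
  · have h3 := Real.pi_gt_d6
    have h4 := Real.pi_lt_d6
    rw [abs_lt, lt_sub_iff_add_lt, sub_lt_iff_lt_add, lt_div_iff₀ hκ, div_lt_iff₀ hκ]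
    constructor <;> linarith
  · have hk : 0 < Real.pi / ρ := div_pos Real.pi_pos hρ
    have h3 := mul_tanh_strictMonoOn.le_iff_le (a := κ) (b := Real.pi / ρ) hκ hk
    simp only [h] at h3
    rw [h3, le_div_iff₀ hρ, le_div_iff₀ hκ, mul_comm]

end SoapFilm

theorem proposition4p1 :
    (∀ σ ρ : ℝ, 0 < σ → 0 < ρ →
      (SoapFilm.SecondVariationStable σ 0 ρ (SoapFilm.flatFilm ρ) ↔
        1 ≤ Real.pi / ρ * Real.tanh (Real.pi / ρ))) ∧
    (∃ ρc : ℝ, |ρc - 2.62| < 0.005 ∧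
      ∀ ρ : ℝ, 0 < ρ → (1 ≤ Real.pi / ρ * Real.tanh (Real.pi / ρ) ↔ ρ ≤ ρc)) :=
  ⟨fun _ _ hσ hρ => ⟨SoapFilm.le_of_secondVariationStable hσ hρ,
    SoapFilm.secondVariationStable_of_le hσ hρ⟩, SoapFilm.exists_critical_length⟩
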